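/- For a positive integer $n$ and $-1/n<\theta<1/n$, let $\mathrm{IS}(n,\theta)$ be the distribution on $\{0,1,\dots,n\}$ with $$\mathrm{IS}(n,\theta)(x)=\frac{1}{Z_n(\theta)}\binom{n}{x}e^{h(n,x)\theta},\qquad h(n,x)=2x^2-2nx+\frac{n(n-1)}{2},\qquad Z_n(\theta)=\sum_{x=0}^{n}\binom{n}{x}e^{h(n,x)\theta}.$$ For distributions $p,q$ on $\{0,\dots,m\}$ let $d_{\mathrm{TV}}(p,q)=\sup_{S}|p(S)-q(S)|$ and, if $q$ has full support, $\chi^2(p,q)=\sum_{x=0}^m p(x)^2/q(x)-1$. There are universal constants $C_0>0$, $\delta_0\in(0,1)$ and $K>0$ such that the following holds. Let $0<\delta<\delta_0$, let $k\ge 1$ be an integer, and let $m$ be an integer with $$m\ \ge\ \max\Big(C_0\big(\log(1/\delta)\big)^3,\ \frac{k^2}{\log(1/\delta)}\Big).$$ Then there is a probability distribution $A$ on $\{0,1,\dots,m\}$ such that (i) $\mathbf{E}_{X\sim A}[X^i]=\mathbf{E}_{X\sim \mathrm{Bin}(m,1/2)}[X^i]$ for all $1\le i\le k$; (ii) $d_{\mathrm{TV}}\big(A,\mathrm{IS}(m,\delta/m)\big)\le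 K\,\dfrac{\delta k^3}{\log(1/\delta)}$; (iii) $\chi^2\big(A,\mathrm{Bin}(m,1/2)\big)\le K\,\delta$. -/

import Mathlib

/-- The exponent `h(n, x) = 2x² - 2nx + n(n - 1)/2` of the symmetric Ising model. -/
noncomputable def isingExponent (n x : ℕ) : ℝ :=
  2 * (x : ℝ) ^ 2 - 2 * (n : ℝ) * (x : ℝ) + (n : ℝ) * ((n : ℝ) - 1) / 2

/-- The partition function `Z_n(δ) = ∑_{x = 0}^{n} C(n, x) exp(h(n, x) δ)`. -/
noncomputable def isingPartition (n : ℕ) (δ : ℝ) : ℝ :=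
  ∑ x ∈ Finset.range (n + 1), (n.choose x : ℝ) * Real.exp (isingExponent n x * δ)

/-- The probability `C(n, x) exp(h(n, x) δ) / Z_n(δ)` that `IS(n, δ)` gives to `x`. -/
noncomputable def isingMass (n : ℕ) (δ : ℝ) (x : ℕ) : ℝ :=
  (n.choose x : ℝ) * Real.exp (isingExponent n x * δ) / isingPartition n δ

/-- The symmetric Ising sum distribution `IS(n, δ)` on `{0, …, n}`, as a measure on `ℕ`. -/
noncomputable def isingSum (n : ℕ) (δ : ℝ) : MeasureTheory.Measure ℕ :=
  ∑ x ∈ Finset.range (n + 1),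
    ENNReal.ofReal (isingMass n δ x) • MeasureTheory.Measure.dirac x

theorem isingPartition_pos (n : ℕ) (δ : ℝ) : 0 < isingPartition n δ := by
  refine Finset.sum_pos (fun x hx => ?_) ⟨0, by simp⟩
  have h : 0 < n.choose x := Nat.choose_pos (by simpa [Nat.lt_succ_iff] using hx)
  exact mul_pos (by exact_mod_cast h) (Real.exp_pos _)

theorem isingMass_nonneg (n : ℕ) (δ : ℝ) (x : ℕ) : 0 ≤ isingMass n δ x :=
  div_nonneg (mul_nonneg (Nat.cast_nonneg _) (Real.exp_pos _).le) (isingPartition_pos n δ).le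

/-- `IS(n, δ)` is a probability distribution. -/
theorem isingSum_isProbabilityMeasure (n : ℕ) (δ : ℝ) :
    MeasureTheory.IsProbabilityMeasure (isingSum n δ) := by
  constructor
  have h : ∑ x ∈ Finset.range (n + 1), isingMass n δ x = 1 := by
    unfold isingMass
    rw [← Finset.sum_div]
    exact div_self (isingPartition_pos n δ).ne'
  have h2 : isingSum n δ Set.univ
      = ∑ x ∈ Finset.range (n + 1), ENNReal.ofReal (isingMass n δ x) := by
    simp [isingSum]
  rw [h2, ← ENNReal.ofReal_sum_of_nonneg (fun x _ => isingMass_nonneg n δ x), h,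
    ENNReal.ofReal_one]

/-- The binomial distribution `Bin(m, 1/2)`, as a measure on `ℕ`. -/
noncomputable def binHalf (m : ℕ) : MeasureTheory.Measure ℕ :=
  ProbabilityTheory.binomial m ⟨1 / 2, by norm_num, by norm_num⟩

/-- The total variation distance `sup_S |μ(S) - ν(S)|` of two distributions on `ℕ` (every subset of
`ℕ` is measurable). For probability measures the supremum is over a set bounded by `1`. -/
noncomputable def tvDistance (μ ν : MeasureTheory.Measure ℕ) : ℝ :=
  ⨆ S : Set ℕ, |μ.real S - ν.real S|

/-- The chi-squared divergence `χ²(μ, ν) = ∑_x μ(x)² / ν(x) - 1` of two distributions on `ℕ`, with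
values in `[0, ∞]`. A term with `ν(x) = 0` is `0` if `μ(x) = 0` and `∞` otherwise, and the sum is at
least `1` for probability measures, so the subtraction does not truncate. -/
noncomputable def chiSquared (μ ν : MeasureTheory.Measure ℕ) : ENNReal :=
  (∑' x : ℕ, μ {x} ^ 2 / ν {x}) - 1

/-! Write `L = log (1/δ)`, so `δ = exp (-L)`, and `s = (2x - m)/√m`. Completing the square shows
that `IS(m, δ/m)` is `Bin(m, 1/2)` tilted by `exp (δ s²/2)`. Since `s` has square-exponential
moments bounded uniformly in `m`, the two laws differ by `O(δ)` in `ℓ¹`, in chi-squared and against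
`s² exp |s|` (`exists_isingMass_sub_binMass_bounds`). If `k³ > L`, the binomial itself is already an
admissible `A`.

If `k³ ≤ L`, take `A = IS + q`, where `q` has the same pairing as `ν = Bin - IS` with every
polynomial of degree at most `k`. By Hahn-Banach (`exists_abs_le_of_le_sum_mul_abs`) such a `q`
exists with `|q| ≤ B w` as soon as `ν` is bounded by `B` times the `w`-weighted `ℓ¹` norm on these
polynomials. Expand a polynomial in the `T_j(s/R)` with `R = √L/4`. Two estimates give the bound: -
the pairing of `ν` with `T_j(s/R)` is `O(δ j²/R²)`: it vanishes for odd `j` by symmetry, and for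
even `j` one may subtract `T_j(0)` because both laws have mass one (`abs_sum_sub_mul_chebyshev_le`);
- each Chebyshev coefficient is at most `4` times the weighted norm, when `w` counts Chebyshev nodes
rounded to integers (`exists_chebyshev_grid_weights`).

Summing over `k + 1` coefficients gives `B = O(δ k³/L)`, the total variation bound. The weights live
on `|s| ≤ R` and are `O(1/√m)`, while the binomial mass there is at least of order `exp (-L/16)/√m`,
far above `δ/√m`; hence `A` is nonnegative, and chi-squared stays `O(δ)`. -/

open Polynomial

/-! ### Standardized binomial and its square-exponential moments. -/

/-- The mass `C(m, x) / 2^m` that `Bin(m, 1/2)` gives to `x`. -/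
noncomputable def binMass (m x : ℕ) : ℝ := (m.choose x : ℝ) / 2 ^ m

/-- The standardized coordinate `(2x - m) / √m`. -/
noncomputable def stdCoord (m x : ℕ) : ℝ := (2 * (x : ℝ) - m) / √m

theorem binMass_nonneg (m x : ℕ) : 0 ≤ binMass m x := by unfold binMass; positivity

theorem binMass_pos {m x : ℕ} (h : x ≤ m) : 0 < binMass m x := by
  have := Nat.choose_pos h
  unfold binMass; positivity

theorem sum_binMass (m : ℕ) : ∑ x ∈ Finset.range (m + 1), binMass m x = 1 := by
  unfold binMass
  rw [← Finset.sum_div, ← Nat.cast_sum, Nat.sum_range_choose]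
  simp

theorem stdCoord_sq {m : ℕ} (x : ℕ) : stdCoord m x ^ 2 = (2 * (x : ℝ) - m) ^ 2 / m := by
  unfold stdCoord
  rw [div_pow, Real.sq_sqrt (Nat.cast_nonneg m)]

theorem binMass_reflect {m x : ℕ} (h : x ≤ m) : binMass m (m - x) = binMass m x := by
  unfold binMass
  rw [Nat.choose_symm h]

theorem stdCoord_reflect {m x : ℕ} (h : x ≤ m) : stdCoord m (m - x) = -stdCoord m x := by
  unfold stdCoord
  rw [Nat.cast_sub h]
  ring

/-- The moment generating function of the standardized `Bin(m, 1/2)` is at most `exp (z² / 2)`. -/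
theorem sum_binMass_mul_exp_le {m : ℕ} (hm : 1 ≤ m) (z : ℝ) :
    ∑ x ∈ Finset.range (m + 1), binMass m x * Real.exp (stdCoord m x * z) ≤
      Real.exp (z ^ 2 / 2) := by
  have hm0 : (0 : ℝ) < m := by exact_mod_cast hm
  have hsq : 0 < √(m : ℝ) := Real.sqrt_pos.2 hm0
  set a := z / √(m : ℝ) with ha
  have h1 : ∑ x ∈ Finset.range (m + 1), binMass m x * Real.exp (stdCoord m x * z) =
      Real.cosh a ^ m := by
    rw [Real.cosh_eq, add_div, add_pow]
    refine Finset.sum_congr rfl fun x hx => ?_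
    have hx' : x ≤ m := by simpa [Nat.lt_succ_iff] using hx
    have h2 : stdCoord m x * z = (x : ℝ) * a + ((m - x : ℕ) : ℝ) * (-a) := by
      rw [Nat.cast_sub hx', ha, stdCoord]
      field_simp
      ring
    rw [h2, Real.exp_add, Real.exp_nat_mul, Real.exp_nat_mul, div_pow, div_pow, binMass]
    have h3 : (2 : ℝ) ^ m = 2 ^ x * 2 ^ (m - x) := by rw [← pow_add]; congr 1; omega
    rw [h3]
    field_simp
  rw [h1]
  calc Real.cosh a ^ m ≤ Real.exp (a ^ 2 / 2) ^ m := by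
        gcongr
        exact Real.cosh_le_exp_half_sq a
    _ = Real.exp (z ^ 2 / 2) := by
        rw [← Real.exp_nat_mul, ha, div_pow, Real.sq_sqrt hm0.le]
        congr 1
        field_simp

theorem integrable_exp_sq_gaussianReal :
    MeasureTheory.Integrable (fun z : ℝ => Real.exp (z ^ 2 / 2))
      (ProbabilityTheory.gaussianReal 0 (1 / 2)) := by
  rw [ProbabilityTheory.gaussianReal_of_var_ne_zero _ (by norm_num),
    MeasureTheory.integrable_withDensity_iff_integrable_smul'
      (ProbabilityTheory.measurable_gaussianPDF _ _)
      (Filter.Eventually.of_forall fun _ => ProbabilityTheory.gaussianPDF_lt_top)]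
  have h := (integrable_exp_neg_mul_sq (b := 1 / 2) (by norm_num)).const_mul
    (√(2 * Real.pi * ((1 / 2 : NNReal) : ℝ)))⁻¹
  refine h.congr (Filter.Eventually.of_forall fun z => ?_)
  simp only [ProbabilityTheory.toReal_gaussianPDF, ProbabilityTheory.gaussianPDFReal, smul_eq_mul]
  conv_rhs => rw [mul_assoc, ← Real.exp_add]
  congr 2
  push_cast
  ring

/-- Square-exponential moments of the standardized `Bin(m, 1/2)` are bounded uniformly in `m`. -/
theorem exists_sum_binMass_mul_exp_sq_le :
    ∃ M : ℝ, 1 ≤ M ∧ ∀ m : ℕ, 1 ≤ m →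
      ∑ x ∈ Finset.range (m + 1), binMass m x * Real.exp (stdCoord m x ^ 2 / 4) ≤ M := by
  set γ := ProbabilityTheory.gaussianReal 0 (1 / 2) with hγ
  refine ⟨max 1 (∫ z, Real.exp (z ^ 2 / 2) ∂γ), le_max_left _ _, fun m hm => ?_⟩
  refine le_trans ?_ (le_max_right _ _)
  -- Gaussian linearization: `exp (s²/4)` is an average of `exp (s z)` over `N(0, 1/2)`, so the
  -- moment generating function bound applies under the integral. The resulting `exp (z²/2)` is
  -- integrable against a density proportional to `exp (-z²)`.
  have hmgf : ∀ s : ℝ, Real.exp (s ^ 2 / 4) = ∫ z, Real.exp (s * z) ∂γ := by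
    intro s
    have := ProbabilityTheory.mgf_gaussianReal (p := γ) (X := id) (μ := 0) (v := 1 / 2)
      (by simp [hγ]) s
    simp only [ProbabilityTheory.mgf, id] at this
    rw [this]
    congr 1
    push_cast
    ring
  have hint : ∀ s : ℝ, MeasureTheory.Integrable (fun z => Real.exp (s * z)) γ :=
    fun s => ProbabilityTheory.integrable_exp_mul_gaussianReal s
  calc ∑ x ∈ Finset.range (m + 1), binMass m x * Real.exp (stdCoord m x ^ 2 / 4)
      = ∫ z, ∑ x ∈ Finset.range (m + 1), binMass m x * Real.exp (stdCoord m x * z) ∂γ := by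
        rw [MeasureTheory.integral_finsetSum _ fun x _ => (hint _).const_mul _]
        refine Finset.sum_congr rfl fun x _ => ?_
        rw [MeasureTheory.integral_const_mul, hmgf]
    _ ≤ ∫ z, Real.exp (z ^ 2 / 2) ∂γ :=
        MeasureTheory.integral_mono
          (MeasureTheory.integrable_finsetSum _ fun x _ => (hint _).const_mul _)
          integrable_exp_sq_gaussianReal (fun z => sum_binMass_mul_exp_le hm z)

/-! ### Hahn-Banach duality. -/

/-- A functional dominated by a weighted `ℓ¹` norm on a subspace is represented there by a vector
dominated by the weight. -/
theorem exists_abs_le_of_le_sum_mul_abs {ι : Type*} [Fintype ι] [DecidableEq ι]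
    (V : Submodule ℝ (ι → ℝ)) (ν w : ι → ℝ) (hw : ∀ i, 0 ≤ w i)
    (h : ∀ v ∈ V, ∑ i, ν i * v i ≤ ∑ i, w i * |v i|) :
    ∃ q : ι → ℝ, (∀ i, |q i| ≤ w i) ∧ ∀ v ∈ V, ∑ i, q i * v i = ∑ i, ν i * v i := by
  let F : (ι → ℝ) →ₗ[ℝ] ℝ := ∑ i, ν i • LinearMap.proj i
  have hF : ∀ v, F v = ∑ i, ν i * v i := fun v => by simp [F]
  -- The extension stays below the weighted seminorm on the whole space; testing it on plus and
  -- minus a basis vector bounds each coordinate by `w i`.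
  obtain ⟨g, hg1, hg2⟩ := exists_extension_of_le_sublinear (E := ι → ℝ)
    ⟨V, F.comp V.subtype⟩ (fun v => ∑ i, w i * |v i|)
    (fun c hc x => by
      simp only [Pi.smul_apply, smul_eq_mul, abs_mul, abs_of_pos hc, Finset.mul_sum]
      exact Finset.sum_congr rfl fun i _ => by ring)
    (fun x y => by
      rw [← Finset.sum_add_distrib]
      refine Finset.sum_le_sum fun i _ => ?_
      rw [← mul_add]
      exact mul_le_mul_of_nonneg_left (abs_add_le _ _) (hw i))
    (fun x => (hF x).trans_le (h x x.2))
  have hsum : ∀ i, ∑ j, w j * |(Pi.single i (1 : ℝ) : ι → ℝ) j| = w i := fun i => by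
    rw [Finset.sum_eq_single i] <;> simp +contextual
  refine ⟨fun i => g (Pi.single i 1), fun i => abs_le.2 ⟨?_, ?_⟩, fun v hv => ?_⟩
  · have := hg2 (-Pi.single i 1)
    simp only [map_neg, Pi.neg_apply, abs_neg, hsum] at this
    linarith
  · have := hg2 (Pi.single i 1)
    rwa [hsum] at this
  · have h1 : g v = ∑ i, g (Pi.single i 1) * v i := by
      conv_lhs => rw [LinearMap.pi_apply_eq_sum_univ g v]
      refine Finset.sum_congr rfl fun i _ => ?_
      rw [smul_eq_mul, mul_comm]
      congr 2
      ext j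
      simp [Pi.single_apply, eq_comm]
    rw [← h1, ← hF]
    exact hg1 ⟨v, hv⟩

/-! ### Lower bounds for binomial coefficients. -/

theorem four_pow_le_two_mul_sqrt_mul_centralBinom (n : ℕ) (hn : 1 ≤ n) :
    (4 : ℝ) ^ n ≤ 2 * √n * n.centralBinom := by
  induction n, hn using Nat.le_induction with
  | base => simp [Nat.centralBinom, Nat.choose]; norm_num
  | succ n hn ih =>
    have h1 : ((n : ℝ) + 1) * (n + 1).centralBinom = 2 * (2 * n + 1) * n.centralBinom := by
      exact_mod_cast Nat.succ_mul_centralBinom_succ n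
    have h2 : (2 * √(n : ℝ)) * √((n + 1 : ℕ) : ℝ) ≤ 2 * n + 1 := by
      refine abs_le_of_sq_le_sq' ?_ (by positivity) |>.2
      rw [mul_pow, mul_pow, Real.sq_sqrt (by positivity), Real.sq_sqrt (by positivity)]
      push_cast
      nlinarith
    have h3 : (0 : ℝ) < n + 1 := by positivity
    have h4 : √((n + 1 : ℕ) : ℝ) ^ 2 = n + 1 := by rw [Real.sq_sqrt (by positivity)]; push_cast; ring
    have h5 : 0 < √((n + 1 : ℕ) : ℝ) := Real.sqrt_pos.2 (by positivity)
    have h6 : (0 : ℝ) ≤ n.centralBinom := by positivity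
    have h7 : (4 : ℝ) ^ n * √((n + 1 : ℕ) : ℝ) ≤ (2 * n + 1) * n.centralBinom := by
      calc (4 : ℝ) ^ n * √((n + 1 : ℕ) : ℝ) ≤ (2 * √n * n.centralBinom) * √((n + 1 : ℕ) : ℝ) := by
            gcongr
        _ = (2 * √(n : ℝ) * √((n + 1 : ℕ) : ℝ)) * n.centralBinom := by ring
        _ ≤ _ := by gcongr
    refine le_of_mul_le_mul_left ?_ h5
    calc √((n + 1 : ℕ) : ℝ) * 4 ^ (n + 1) = 4 * (4 ^ n * √((n + 1 : ℕ) : ℝ)) := by ring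
      _ ≤ 4 * ((2 * n + 1) * n.centralBinom) := by gcongr
      _ = 2 * (((n : ℝ) + 1) * (n + 1).centralBinom) := by rw [h1]; ring
      _ = √((n + 1 : ℕ) : ℝ) * (2 * √((n + 1 : ℕ) : ℝ) * (n + 1).centralBinom) := by
          rw [← h4]; ring

theorem two_pow_le_sqrt_mul_choose_half (m : ℕ) (hm : 1 ≤ m) :
    (2 : ℝ) ^ m ≤ 4 * √m * m.choose (m / 2) := by
  rcases Nat.even_or_odd' m with ⟨n, rfl | rfl⟩
  · have h := four_pow_le_two_mul_sqrt_mul_centralBinom n (by omega)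
    rw [show 2 * n / 2 = n by omega, pow_mul]
    norm_num only
    refine h.trans ?_
    rw [Nat.centralBinom]
    gcongr
    · norm_num
    · omega
  · have h := four_pow_le_two_mul_sqrt_mul_centralBinom (n + 1) (by omega)
    have h2 : (n + 1).centralBinom = 2 * (2 * n + 1).choose n := by
      rw [Nat.centralBinom, show 2 * (n + 1) = (2 * n + 1) + 1 by ring, Nat.choose_succ_succ,
        Nat.choose_symm_half]
      ring
    have h3 : √((n + 1 : ℕ) : ℝ) ≤ √((2 * n + 1 : ℕ) : ℝ) := by gcongr; omega
    rw [h2] at h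
    rw [show (2 * n + 1) / 2 = n by omega]
    push_cast at h h3 ⊢
    have h4 : (0 : ℝ) ≤ (2 * n + 1).choose n := by positivity
    have h5 : (2 : ℝ) ^ (2 * n + 1) * 2 = 4 ^ (n + 1) := by
      rw [← pow_succ, show 2 * n + 1 + 1 = 2 * (n + 1) by ring, pow_mul]; norm_num
    have h6 := mul_le_mul_of_nonneg_right h3 h4
    have h7 : (0:ℝ) ≤ √(2 * (n : ℝ) + 1) * (2 * n + 1).choose n := by positivity
    nlinarith

theorem exp_neg_two_mul_le_one_sub {t : ℝ} (h0 : 0 ≤ t) (h1 : t ≤ 1 / 2) :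
    Real.exp (-(2 * t)) ≤ 1 - t := by
  rw [Real.exp_neg]
  refine inv_le_of_inv_le₀ (by linarith) (le_trans ?_ (Real.add_one_le_exp _))
  rw [inv_le_iff_one_le_mul₀ (by linarith)]
  nlinarith

/-- Step outwards from the centre. With `e = m - 2x`, the ratio of neighbouring coefficients is
`(x+1)/(m-x) = 1 - (e-1)/(m-x) ≥ 1 - 2(e-1)/m ≥ exp (-4(e-1)/m)`, and these exponents telescope
because `e² - (e-2)² = 4(e-1)`. -/
theorem choose_half_mul_exp_le_choose {m : ℕ} (j : ℕ) (x : ℕ) (hx : x + j = m / 2)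
    (h : (m : ℝ) - 2 * x ≤ m / 4) :
    (m.choose (m / 2) : ℝ) * Real.exp (-((2 * (x : ℝ) - m) ^ 2 / m)) ≤ m.choose x := by
  induction j generalizing x with
  | zero =>
    rw [add_zero] at hx
    rw [← hx]
    refine mul_le_of_le_one_right (by positivity) (Real.exp_le_one_iff.2 ?_)
    have : 0 ≤ (2 * (x : ℝ) - m) ^ 2 / m := by positivity
    linarith
  | succ j ih =>
    have hxm : x + 1 ≤ m / 2 := by omega
    have hm2 : 2 * (x + 1) ≤ m := by omega
    have hm2' : 2 * ((x : ℝ) + 1) ≤ m := by exact_mod_cast hm2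
    have hm0 : (0 : ℝ) < m := by
      have : (0 : ℝ) ≤ x := Nat.cast_nonneg x
      linarith
    have ih' := ih (x + 1) (by omega) (by push_cast; linarith)
    have hrec : (m.choose (x + 1) : ℝ) * (x + 1) = m.choose x * (m - x) := by
      have := Nat.choose_succ_right_eq m x
      have h2 : ((m - x : ℕ) : ℝ) = m - x := by rw [Nat.cast_sub (by omega)]
      rw [← h2]
      exact_mod_cast this
    set e : ℝ := m - 2 * x with he
    have he2 : 2 ≤ e := by rw [he]; linarith
    have hmx : (0 : ℝ) < m - x := by linarith
    have hexp : Real.exp (-(4 * (e - 1) / m)) ≤ (x + 1) / (m - x) := by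
      have h1 := exp_neg_two_mul_le_one_sub (t := 2 * (e - 1) / m) (by
          apply div_nonneg <;> linarith)
        (by rw [div_le_iff₀ hm0]; linarith)
      rw [show -(4 * (e - 1) / m) = -(2 * (2 * (e - 1) / m)) by ring]
      refine h1.trans ?_
      rw [le_div_iff₀ hmx, one_sub_mul, div_mul_eq_mul_div]
      have : m - (x : ℝ) - (x + 1) ≤ 2 * (e - 1) * (m - x) / m := by
        rw [le_div_iff₀ hm0]
        have : m - (x : ℝ) - (x + 1) = e - 1 := by rw [he]; ring
        rw [this]
        nlinarith
      linarith
    have hsplit : Real.exp (-((2 * (x : ℝ) - m) ^ 2 / m)) =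
        Real.exp (-((2 * ((x + 1 : ℕ) : ℝ) - m) ^ 2 / m)) * Real.exp (-(4 * (e - 1) / m)) := by
      rw [← Real.exp_add]
      congr 1
      rw [he]
      push_cast
      field_simp
      ring
    rw [hsplit, ← mul_assoc]
    calc _ ≤ (m.choose (x + 1) : ℝ) * ((x + 1) / (m - x)) := by gcongr
      _ = m.choose x := by rw [← mul_div_assoc, hrec]; field_simp

/-- A Gaussian lower bound for the mass of `Bin(m, 1/2)` in the bulk. -/
theorem exp_neg_stdCoord_sq_le_binMass {m x : ℕ} (hm : 1 ≤ m) (hx : x ≤ m)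
    (h : |2 * (x : ℝ) - m| ≤ m / 4) :
    Real.exp (-stdCoord m x ^ 2) / (4 * √m) ≤ binMass m x := by
  wlog hxm : x ≤ m / 2 generalizing x
  · have := this (x := m - x) (by omega) (by
      rw [Nat.cast_sub hx, ← abs_neg]
      convert h using 2
      ring) (by omega)
    rwa [stdCoord_reflect hx, binMass_reflect hx, neg_sq] at this
  have hm0 : (0 : ℝ) < √(m : ℝ) := Real.sqrt_pos.2 (by exact_mod_cast hm)
  have h1 := choose_half_mul_exp_le_choose (m := m) (m / 2 - x) x (by omega)
    (by linarith [(abs_le.1 h).1])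
  have h2 := two_pow_le_sqrt_mul_choose_half m hm
  rw [stdCoord_sq, binMass, div_le_div_iff₀ (by positivity) (by positivity)]
  calc _ ≤ Real.exp (-((2 * (x : ℝ) - m) ^ 2 / m)) * (4 * √m * m.choose (m / 2)) := by gcongr
    _ = (m.choose (m / 2) * Real.exp (-((2 * (x : ℝ) - m) ^ 2 / m))) * (4 * √m) := by ring
    _ ≤ _ := by gcongr

/-! ### Growth of Chebyshev polynomials. -/

theorem abs_sin_nat_mul_le (n : ℕ) (x : ℝ) : |Real.sin (n * x)| ≤ n * |Real.sin x| := by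
  induction n with
  | zero => simp
  | succ n ih =>
    push_cast
    rw [add_mul, one_mul, Real.sin_add]
    calc _ ≤ |Real.sin (n * x) * Real.cos x| + |Real.cos (n * x) * Real.sin x| := abs_add_le _ _
      _ ≤ |Real.sin (n * x)| * 1 + 1 * |Real.sin x| := by
        rw [abs_mul, abs_mul]
        gcongr
        · exact Real.abs_cos_le_one _
        · exact Real.abs_cos_le_one _
      _ ≤ _ := by linarith

/-- `T_n` is `n²`-Lipschitz on `[-1, 1]`. -/
theorem abs_chebyshev_T_sub_le (n : ℕ) {u v : ℝ} (hu : |u| ≤ 1) (hv : |v| ≤ 1) :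
    |(Chebyshev.T ℝ n).eval u - (Chebyshev.T ℝ n).eval v| ≤ (n : ℝ) ^ 2 * |u - v| := by
  rw [abs_le] at hu hv
  rw [← Real.cos_arccos hu.1 hu.2, ← Real.cos_arccos hv.1 hv.2]
  set α := Real.arccos u
  set β := Real.arccos v
  rw [Chebyshev.T_real_cos, Chebyshev.T_real_cos, Real.cos_sub_cos, Real.cos_sub_cos]
  have h1 := abs_sin_nat_mul_le n ((α + β) / 2)
  have h2 := abs_sin_nat_mul_le n ((α - β) / 2)
  push_cast
  rw [show ((n : ℝ) * α + n * β) / 2 = n * ((α + β) / 2) by ring,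
    show ((n : ℝ) * α - n * β) / 2 = n * ((α - β) / 2) by ring]
  simp only [abs_mul, abs_neg, abs_two]
  have := mul_le_mul h1 h2 (abs_nonneg _) (by positivity)
  nlinarith

/-- Deviation of an even Chebyshev polynomial from its value at `0`, on the whole line. -/
theorem abs_chebyshev_T_two_mul_sub_le (n : ℕ) (u : ℝ) :
    |(Chebyshev.T ℝ (2 * n : ℕ)).eval u - (Chebyshev.T ℝ (2 * n : ℕ)).eval 0| ≤
      2 * (n : ℝ) ^ 2 * u ^ 2 * Real.cosh (2 * n * u) := by
  rcases Nat.eq_zero_or_pos n with rfl | hn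
  · simp
  have hn1 : (1 : ℝ) ≤ n := by exact_mod_cast hn
  rcases le_or_gt |u| 1 with hu | hu
  · rw [abs_le] at hu
    -- With `u = sin ψ` one has `T_{2n}(u) = (-1)^n cos (2nψ)`, so the deviation from `u = 0` is `2
    -- sin² (nψ) ≤ 2n²u²`.
    have h1 : u = Real.cos (Real.pi / 2 - Real.arcsin u) := by
      rw [Real.cos_pi_div_two_sub, Real.sin_arcsin hu.1 hu.2]
    set ψ := Real.arcsin u with hψ
    have hsin : Real.sin ψ = u := Real.sin_arcsin hu.1 hu.2
    have h0 : (0 : ℝ) = Real.cos (Real.pi / 2) := Real.cos_pi_div_two.symm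
    conv_lhs => rw [h1, h0]
    rw [Chebyshev.T_real_cos, Chebyshev.T_real_cos]
    have e1 : ((2 * n : ℕ) : ℤ) * (Real.pi / 2 - ψ) = n * Real.pi - 2 * (n * ψ) := by
      push_cast; ring
    have e2 : ((2 * n : ℕ) : ℤ) * (Real.pi / 2) = n * Real.pi := by push_cast; ring
    rw [e1, e2, Real.cos_sub, Real.sin_nat_mul_pi, zero_mul, add_zero, Real.cos_two_mul,
      ← mul_sub_one, abs_mul, Real.cos_nat_mul_pi]
    have h3 := abs_sin_nat_mul_le n ψ
    rw [hsin] at h3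
    have h4 : 2 * Real.cos (n * ψ) ^ 2 - 1 - 1 = -(2 * |Real.sin (n * ψ)| ^ 2) := by
      rw [sq_abs, Real.sin_sq]; ring
    rw [h4, abs_neg, abs_pow, abs_neg, abs_one, one_pow, one_mul, abs_of_nonneg (by positivity)]
    have h5 : |Real.sin (n * ψ)| ^ 2 ≤ (n * |u|) ^ 2 := by gcongr
    rw [mul_pow, sq_abs u] at h5
    have h6 := Real.one_le_cosh (2 * n * u)
    have h7 : 0 ≤ 2 * (n : ℝ) ^ 2 * u ^ 2 := by positivity
    nlinarith
  · have heven : (Chebyshev.T ℝ (2 * n : ℕ)).eval u = (Chebyshev.T ℝ (2 * n : ℕ)).eval |u| := by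
      rcases abs_choice u with h | h <;> rw [h]
      rw [Chebyshev.T_eval_neg]
      simp
    have h0 : |(Chebyshev.T ℝ (2 * n : ℕ)).eval (0 : ℝ)| ≤ 1 :=
      Chebyshev.abs_eval_T_real_le_one _ (by simp)
    have hcosh : Real.cosh (2 * n * u) = Real.cosh (2 * n * |u|) := by
      rw [← Real.cosh_abs, abs_mul, abs_of_nonneg (by positivity : (0 : ℝ) ≤ 2 * n)]
    -- Outside `[-1, 1]` write `|u| = cosh t` with `t ≤ |u|`. The crude bound `2 cosh (2nu)` on the
    -- difference suffices, since `n²u² ≥ 1` there.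
    have hT : |(Chebyshev.T ℝ (2 * n : ℕ)).eval u| ≤ Real.cosh (2 * n * u) := by
      rw [heven, hcosh]
      have ht : |u| = Real.cosh (Real.arcosh |u|) := (Real.cosh_arcosh hu.le).symm
      have ht0 := Real.arcosh_nonneg hu.le
      set t := Real.arcosh |u|
      have htu : t ≤ |u| := by
        rw [ht]
        calc t ≤ Real.sinh t := Real.self_le_sinh_iff.2 ht0
          _ ≤ Real.cosh t := (Real.sinh_lt_cosh t).le
      conv_lhs => rw [ht]
      rw [Chebyshev.T_real_cosh, abs_of_pos (Real.cosh_pos _), Real.cosh_le_cosh]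
      push_cast
      rw [abs_of_nonneg (by positivity), abs_of_nonneg (by positivity)]
      gcongr
    have h6 := Real.one_le_cosh (2 * n * u)
    have h7 : 1 ≤ (n : ℝ) ^ 2 * u ^ 2 := by
      rw [← sq_abs u, ← mul_pow]
      exact one_le_pow₀ (by nlinarith)
    calc _ ≤ |(Chebyshev.T ℝ (2 * n : ℕ)).eval u| + |(Chebyshev.T ℝ (2 * n : ℕ)).eval (0 : ℝ)| :=
          abs_sub _ _
      _ ≤ 2 * Real.cosh (2 * n * u) := by linarith
      _ ≤ _ := by nlinarith

/-! ### Chebyshev angles and weights on the integer grid. -/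

theorem card_le_of_sub_le {s : Finset ℕ} {D : ℝ} (hD : 0 ≤ D)
    (h : ∀ a ∈ s, ∀ b ∈ s, a ≤ b → (b : ℝ) - a ≤ D) : (s.card : ℝ) ≤ D + 1 := by
  rcases s.eq_empty_or_nonempty with rfl | hs
  · simp; linarith
  have hsub : s ⊆ Finset.Icc (s.min' hs) (s.min' hs + ⌊D⌋₊) := fun b hb => by
    have h1 := Finset.min'_le s b hb
    have h2 := h _ (s.min'_mem hs) b hb h1
    rw [← Nat.cast_sub h1] at h2
    have := Nat.le_floor h2
    rw [Finset.mem_Icc]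
    omega
  have h1 := Finset.card_le_card hsub
  rw [Nat.card_Icc] at h1
  have h2 : s.card ≤ ⌊D⌋₊ + 1 := by omega
  calc (s.card : ℝ) ≤ (⌊D⌋₊ : ℝ) + 1 := by exact_mod_cast h2
    _ ≤ D + 1 := by gcongr; exact Nat.floor_le hD

/-- The `l`-th Chebyshev angle `(2l + 1)π / (2N)`. -/
noncomputable def chebyshevAngle (N l : ℕ) : ℝ := (2 * l + 1) / (2 * N) * Real.pi

theorem sum_cos_mul_chebyshevAngle {N : ℕ} (hN : N ≠ 0) {n : ℤ} (hn : ¬ (2 * N : ℤ) ∣ n) :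
    ∑ l ∈ Finset.range N, Real.cos (n * chebyshevAngle N l) = 0 := by
  have h := Chebyshev.sumZeroes_T_of_not_dvd hn
  simp only [Chebyshev.sumZeroes, Chebyshev.T_real_cos] at h
  have hN' : (N : ℝ) ≠ 0 := by exact_mod_cast hN
  have h2 := (mul_eq_zero.1 h).resolve_left (by positivity)
  exact h2

/-- Product-to-sum: the frequencies `i - j` and `i + j` are nonzero and smaller than `2N` in
absolute value, so both cosine sums vanish. -/
theorem sum_cos_mul_cos_chebyshevAngle_of_ne {N i j : ℕ} (hi : i < N) (hj : j < N) (h : i ≠ j) :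
    ∑ l ∈ Finset.range N, Real.cos (i * chebyshevAngle N l) * Real.cos (j * chebyshevAngle N l) =
      0 := by
  have e : ∀ l, Real.cos (i * chebyshevAngle N l) * Real.cos (j * chebyshevAngle N l) =
      (Real.cos (((i - j : ℤ)) * chebyshevAngle N l) +
        Real.cos (((i + j : ℤ)) * chebyshevAngle N l)) / 2 := fun l => by
    rw [eq_div_iff two_ne_zero, mul_comm _ (2 : ℝ), ← mul_assoc, Real.two_mul_cos_mul_cos]
    push_cast
    ring_nf
  have hN : N ≠ 0 := by omega
  simp_rw [e]
  rw [← Finset.sum_div, Finset.sum_add_distrib, sum_cos_mul_chebyshevAngle hN,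
    sum_cos_mul_chebyshevAngle hN]
  · simp
  · rintro ⟨c, hc⟩
    have : c < 1 := by nlinarith
    have : 0 < (i : ℤ) + j := by omega
    have : 0 < c := by by_contra! hc0; nlinarith
    omega
  · rintro ⟨c, hc⟩
    have h1 : c < 1 := by nlinarith
    have h2 : -1 < c := by nlinarith
    have : c = 0 := by omega
    subst this
    omega

theorem half_le_sum_cos_sq_chebyshevAngle {N i : ℕ} (hi : i < N) :
    (N : ℝ) / 2 ≤ ∑ l ∈ Finset.range N, Real.cos (i * chebyshevAngle N l) ^ 2 := by
  have hN : N ≠ 0 := by omega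
  rcases Nat.eq_zero_or_pos i with rfl | hi0
  · simp
  · have e : ∀ l, Real.cos (i * chebyshevAngle N l) ^ 2 =
        1 / 2 + Real.cos ((2 * i : ℤ) * chebyshevAngle N l) / 2 := fun l => by
      rw [Real.cos_sq]
      push_cast
      ring_nf
    simp_rw [e]
    rw [Finset.sum_add_distrib, ← Finset.sum_div, ← Finset.sum_div,
      sum_cos_mul_chebyshevAngle hN]
    · simp [div_eq_mul_inv]
    · rintro ⟨c, hc⟩
      have h1 : c < 1 := by nlinarith
      have h2 : 0 < c := by nlinarith
      omega

/-- Coefficients of a cosine polynomial are controlled by its mean absolute value over the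
Chebyshev angles. -/
theorem abs_coeff_mul_le_sum_abs {N k i : ℕ} (hk : k < N) (hi : i ≤ k) (a : ℕ → ℝ) :
    |a i| * N ≤ 2 * ∑ l ∈ Finset.range N,
      |∑ j ∈ Finset.range (k + 1), a j * Real.cos (j * chebyshevAngle N l)| := by
  -- Pairing with `cos (i φ)` isolates `a i` by discrete orthogonality.
  have h1 : ∑ l ∈ Finset.range N, (∑ j ∈ Finset.range (k + 1),
      a j * Real.cos (j * chebyshevAngle N l)) * Real.cos (i * chebyshevAngle N l) =
      a i * ∑ l ∈ Finset.range N, Real.cos (i * chebyshevAngle N l) ^ 2 := by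
    simp_rw [Finset.sum_mul]
    rw [Finset.sum_comm, Finset.sum_eq_single i]
    · rw [Finset.mul_sum]
      exact Finset.sum_congr rfl fun l _ => by ring
    · intro j hj hji
      simp_rw [mul_assoc]
      rw [← Finset.mul_sum, sum_cos_mul_cos_chebyshevAngle_of_ne
        (by rw [Finset.mem_range] at hj; omega) (by omega) hji, mul_zero]
    · intro h
      rw [Finset.mem_range] at h
      omega
  have h2 := half_le_sum_cos_sq_chebyshevAngle (N := N) (i := i) (by omega)
  have h3 : |∑ l ∈ Finset.range N, (∑ j ∈ Finset.range (k + 1),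
      a j * Real.cos (j * chebyshevAngle N l)) * Real.cos (i * chebyshevAngle N l)| ≤
      ∑ l ∈ Finset.range N,
        |∑ j ∈ Finset.range (k + 1), a j * Real.cos (j * chebyshevAngle N l)| := by
    refine (Finset.abs_sum_le_sum_abs _ _).trans (Finset.sum_le_sum fun l _ => ?_)
    rw [abs_mul]
    exact mul_le_of_le_one_right (abs_nonneg _) (Real.abs_cos_le_one _)
  have h0 : 0 ≤ ∑ l ∈ Finset.range N, Real.cos (i * chebyshevAngle N l) ^ 2 := by positivity
  rw [h1, abs_mul, abs_of_nonneg h0] at h3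
  have h4 := mul_le_mul_of_nonneg_left h2 (abs_nonneg (a i))
  linarith

theorem le_sin_of_mem {α φ : ℝ} (hα : 0 ≤ α) (h1 : α ≤ φ)
    (h2 : φ ≤ Real.pi - α) : 2 / Real.pi * α ≤ Real.sin φ := by
  have h0 : (0 : ℝ) ≤ 2 / Real.pi := by positivity
  rcases le_total φ (Real.pi / 2) with h | h
  · exact (mul_le_mul_of_nonneg_left h1 h0).trans (Real.mul_le_sin (by linarith) h)
  · rw [← Real.sin_pi_sub]
    exact (mul_le_mul_of_nonneg_left (by linarith) h0).trans
      (Real.mul_le_sin (by linarith) (by linarith))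

/-- The cosine difference is a product of two sines, each bounded below by Jordan's inequality;
staying `α` away from the endpoints controls the sine of the midpoint. This separates the Chebyshev
nodes and limits how many round to one integer. -/
theorem cos_sub_cos_ge {α φ ψ : ℝ} (hα : 0 ≤ α) (h1 : α ≤ φ)
    (hφψ : φ ≤ ψ) (h2 : ψ ≤ Real.pi - α) :
    2 * (2 / Real.pi * α) * (2 / Real.pi * ((ψ - φ) / 2)) ≤ Real.cos φ - Real.cos ψ := by
  have e : Real.cos φ - Real.cos ψ =
      2 * Real.sin ((φ + ψ) / 2) * Real.sin ((ψ - φ) / 2) := by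
    rw [Real.cos_sub_cos, show (φ - ψ) / 2 = -((ψ - φ) / 2) by ring, Real.sin_neg]
    ring
  have h3 := le_sin_of_mem hα (φ := (φ + ψ) / 2) (by linarith) (by linarith)
  have h4 := Real.mul_le_sin (x := (ψ - φ) / 2) (by linarith) (by linarith)
  have h5 : 0 ≤ 2 / Real.pi * α := by positivity
  have h6 : 0 ≤ 2 / Real.pi * ((ψ - φ) / 2) := mul_nonneg (by positivity) (by linarith)
  rw [e, mul_assoc 2, mul_assoc 2]
  exact mul_le_mul_of_nonneg_left (mul_le_mul h3 h4 h6 (h5.trans h3)) zero_le_two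

/-- The trimmed Chebyshev angles, away from `0` and `π`. -/
def trimmedIndices (k n : ℕ) : Finset ℕ := Finset.Ico n (16 * (k + 1) * n - n)

theorem chebyshevAngle_bounds {k n l : ℕ} (hl : l ∈ trimmedIndices k n) :
    (n : ℝ) * Real.pi / (16 * (k + 1) * n : ℕ) ≤ chebyshevAngle (16 * (k + 1) * n) l ∧
      chebyshevAngle (16 * (k + 1) * n) l ≤
        Real.pi - (n : ℝ) * Real.pi / (16 * (k + 1) * n : ℕ) := by
  rw [trimmedIndices, Finset.mem_Ico] at hl
  set N := 16 * (k + 1) * n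
  have hN : (0 : ℝ) < N := by exact_mod_cast (show 0 < N by omega)
  have h1 : (n : ℝ) ≤ l := by exact_mod_cast hl.1
  have h2 : (l : ℝ) + n + 1 ≤ N := by exact_mod_cast (show l + n + 1 ≤ N by omega)
  have hpi := Real.pi_pos
  have e : chebyshevAngle N l = (l + 1 / 2) * Real.pi / N := by
    rw [chebyshevAngle]; field_simp
  rw [e]
  constructor
  · gcongr
    linarith
  · rw [le_sub_iff_add_le, ← add_div, div_le_iff₀ hN, ← add_mul, mul_comm Real.pi]
    gcongr
    linarith

/-- Weights on the grid `η (x - m / 2)`, obtained by rounding Chebyshev nodes, whose weighted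
`ℓ¹` norm controls the Chebyshev coefficients of polynomials of degree at most `k`. -/
theorem exists_chebyshev_grid_weights {k m : ℕ} (hk : 1 ≤ k) {η : ℝ} (hη : 0 < η)
    (hηm : 2 ≤ η * m) (hηk : η * (512 * (k : ℝ) ^ 3) ≤ 1) :
    ∃ w : ℕ → ℝ, (∀ x, 0 ≤ w x) ∧ (∀ x, w x ≤ 5 * ((k : ℝ) + 1) * η) ∧
      (∀ x, w x ≠ 0 → |η * ((x : ℝ) - m / 2)| ≤ 1) ∧
      ∑ x ∈ Finset.range (m + 1), w x ≤ 1 ∧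
      ∀ a : ℕ → ℝ, ∀ i ≤ k, |a i| ≤ 4 * ∑ x ∈ Finset.range (m + 1), w x *
        |∑ j ∈ Finset.range (k + 1),
          a j * (Chebyshev.T ℝ j).eval (η * ((x : ℝ) - m / 2))| := by
  set n := ⌈1 / η⌉₊ with hn
  have hηn : 1 ≤ η * n := by
    have := Nat.le_ceil (1 / η)
    rw [div_le_iff₀ hη] at this
    rw [mul_comm]; exact this
  have hn0 : 0 < n := Nat.ceil_pos.2 (by positivity)
  -- Dropping `n` angles at each end discards a proportion `1/(8(k+1))`: little enough for the
  -- supremum bound on a cosine polynomial to absorb, yet the remaining sines are at least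
  -- `1/(8(k+1))`.
  set N := 16 * (k + 1) * n with hNdef
  have hN0 : 0 < N := by positivity
  have hNR : (N : ℝ) = 16 * (k + 1) * n := by rw [hNdef]; push_cast; ring
  have hNpos : (0 : ℝ) < N := by exact_mod_cast hN0
  have hnpos : (0 : ℝ) < n := by exact_mod_cast hn0
  have hk1 : (1 : ℝ) ≤ k := by exact_mod_cast hk
  have hpi := Real.pi_pos
  set φ := chebyshevAngle N with hφ
  set K := trimmedIndices k n with hK
  set α : ℝ := (n : ℝ) * Real.pi / N with hα
  have hα0 : 0 ≤ α := by positivity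
  have hα1 : 2 / Real.pi * α = 1 / (8 * (k + 1)) := by
    rw [hα, hNR]; field_simp; norm_num
  have hφK : ∀ l ∈ K, α ≤ φ l ∧ φ l ≤ Real.pi - α := fun l hl => chebyshevAngle_bounds hl
  have hk2 : (k : ℝ) + 1 ≤ 2 * k := by linarith
  set X : ℕ → ℕ := fun l => ⌊(m : ℝ) / 2 + Real.cos (φ l) / η⌋₊ with hX
  have hpos : ∀ l, 0 ≤ (m : ℝ) / 2 + Real.cos (φ l) / η := fun l => by
    have h1 : -1 / η ≤ Real.cos (φ l) / η := by gcongr; exact Real.neg_one_le_cos _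
    have h2 : 1 / η ≤ (m : ℝ) / 2 := by rw [div_le_iff₀ hη]; linarith
    rw [neg_div] at h1
    linarith
  have hXm : ∀ l, X l ≤ m := fun l => by
    have h1 : Real.cos (φ l) / η ≤ 1 / η := by gcongr; exact Real.cos_le_one _
    have h2 : 1 / η ≤ (m : ℝ) / 2 := by rw [div_le_iff₀ hη]; linarith
    exact Nat.floor_le_of_le (by linarith)
  have hXle : ∀ l, η * ((X l : ℝ) - m / 2) ≤ Real.cos (φ l) := fun l => by
    have h1 : (X l : ℝ) ≤ (m : ℝ) / 2 + Real.cos (φ l) / η := Nat.floor_le (hpos l)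
    calc η * ((X l : ℝ) - m / 2) ≤ η * (Real.cos (φ l) / η) := by gcongr; linarith
      _ = _ := by field_simp
  have hXge : ∀ l, Real.cos (φ l) ≤ η * ((X l : ℝ) - m / 2) + η := fun l => by
    have h1 : (m : ℝ) / 2 + Real.cos (φ l) / η < (X l : ℝ) + 1 := Nat.lt_floor_add_one _
    calc Real.cos (φ l) = η * (Real.cos (φ l) / η) := by field_simp
      _ ≤ η * ((X l : ℝ) + 1 - m / 2) := by gcongr; linarith
      _ = _ := by ring
  have hXabs : ∀ l ∈ K, |η * ((X l : ℝ) - m / 2)| ≤ 1 := fun l hl => by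
    have h1 := le_sin_of_mem hα0 (hφK l hl).1 (hφK l hl).2
    rw [hα1] at h1
    have h2 := Real.sin_sq_add_cos_sq (φ l)
    have h3 : 1 / (16 * k) ≤ Real.sin (φ l) := by
      refine le_trans ?_ h1
      apply one_div_le_one_div_of_le <;> linarith
    have h4 : (1 / (16 * (k : ℝ))) ^ 2 ≤ Real.sin (φ l) ^ 2 := by gcongr
    -- `sin² ≥ 2η` leaves a margin `η` between the cosine and `-1`, so rounding down cannot leave
    -- `[-1, 1]`.
    have h5 : 2 * η ≤ (1 / (16 * (k : ℝ))) ^ 2 := by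
      rw [div_pow, le_div_iff₀ (by positivity)]
      have : (k : ℝ) ^ 2 ≤ k ^ 3 := by gcongr; norm_num
      nlinarith
    have h6 := Real.cos_le_one (φ l)
    have h7 := Real.neg_one_le_cos (φ l)
    rw [abs_le]
    constructor
    · nlinarith [hXge l]
    · linarith [hXle l]
  -- The weight of `x` is the number of kept angles whose node rounds down to `x`, divided by `N`.
  refine ⟨fun x => (∑ l ∈ K, if X l = x then 1 else 0) / N, fun x => by positivity, fun x => ?_,
    fun x hx => ?_, ?_, fun a i hi => ?_⟩
  · rw [div_le_iff₀ hNpos, Finset.sum_boole]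
    -- Nodes rounding to the same integer have cosines within `η`, so their indices spread over at
    -- most `4(k+1)ηN`. The extra `1` is absorbed below because `(k+1)ηN ≥ 1`.
    have hcard : (((K.filter fun l => X l = x).card : ℕ) : ℝ) ≤ 4 * (k + 1) * η * N + 1 := by
      refine card_le_of_sub_le (by positivity) fun l hl l' hl' hll => ?_
      rw [Finset.mem_filter] at hl hl'
      have h1 := cos_sub_cos_ge hα0 (hφK l hl.1).1 (ψ := φ l') (by
        have : (l : ℝ) ≤ l' := by exact_mod_cast hll
        simp only [hφ, chebyshevAngle]
        gcongr) (hφK l' hl'.1).2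
      have h2 := hXge l
      have h3 := hXle l'
      rw [hl.2] at h2
      rw [hl'.2] at h3
      have h4 : 2 / Real.pi * ((φ l' - φ l) / 2) = ((l' : ℝ) - l) / N := by
        simp only [hφ, chebyshevAngle]
        field_simp
        ring
      rw [hα1, h4] at h1
      have h5 : 2 * (1 / (8 * ((k : ℝ) + 1))) * (((l' : ℝ) - l) / N) ≤ η := by linarith
      have h6 : 2 * (1 / (8 * ((k : ℝ) + 1))) * (((l' : ℝ) - l) / N) =
          ((l' : ℝ) - l) / (4 * (k + 1) * N) := by field_simp; ring
      rw [h6, div_le_iff₀ (by positivity)] at h5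
      linarith
    have h7 : 1 ≤ (k + 1) * η * N := by
      rw [hNR]
      have : (k + 1) * η * (16 * (k + 1) * n) = 16 * (k + 1) ^ 2 * (η * n) := by ring
      rw [this]
      nlinarith
    linarith
  · have h1 : ∑ l ∈ K, (if X l = x then (1 : ℝ) else 0) ≠ 0 := fun h => hx (by simp only [h, zero_div])
    obtain ⟨l, hl, hlx⟩ := Finset.exists_ne_zero_of_sum_ne_zero h1
    have : X l = x := by by_contra h; simp [h] at hlx
    rw [← this]
    exact hXabs l hl
  all_goals
    have hswap : ∀ F : ℕ → ℝ, ∑ x ∈ Finset.range (m + 1),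
        (∑ l ∈ K, if X l = x then (1 : ℝ) else 0) / N * F x = (∑ l ∈ K, F (X l)) / N := fun F => by
      rw [Finset.sum_div]
      simp_rw [Finset.sum_div, Finset.sum_mul]
      rw [Finset.sum_comm]
      refine Finset.sum_congr rfl fun l _ => ?_
      rw [Finset.sum_eq_single (X l)]
      · simp [div_eq_inv_mul]
      · intro y _ hy
        simp [Ne.symm hy]
      · intro h
        exact absurd (Finset.mem_range.2 (Nat.lt_succ_of_le (hXm l))) h
    have hKN : K ⊆ Finset.range N := fun l hl => by
      rw [hK, trimmedIndices, Finset.mem_Ico] at hl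
      rw [Finset.mem_range]
      omega
  · have h1 := hswap fun _ => 1
    simp only [mul_one] at h1
    rw [h1, div_le_one hNpos, Finset.sum_const, nsmul_eq_mul, mul_one]
    have := Finset.card_le_card hKN
    rw [Finset.card_range] at this
    exact_mod_cast this
  · rw [hswap fun x => |∑ j ∈ Finset.range (k + 1),
      a j * (Chebyshev.T ℝ j).eval (η * ((x : ℝ) - m / 2))|]
    set P : ℕ → ℝ := fun l => ∑ j ∈ Finset.range (k + 1), a j * Real.cos (j * φ l) with hP
    set Q : ℕ → ℝ := fun l => ∑ j ∈ Finset.range (k + 1),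
      a j * (Chebyshev.T ℝ j).eval (η * ((X l : ℝ) - m / 2)) with hQ
    set S := (∑ l ∈ Finset.range N, |P l|) / N with hS
    have hkN : k < N := by
      have : k + 1 ≤ 16 * (k + 1) * n := by nlinarith
      omega
    have hcoef : ∀ j ≤ k, |a j| ≤ 2 * S := fun j hj => by
      have := abs_coeff_mul_le_sum_abs hkN hj a
      rw [hS, ← mul_div_assoc, le_div_iff₀ hNpos]
      exact this
    have hS0 : 0 ≤ S := by positivity
    have hsupP : ∀ l, |P l| ≤ 2 * (k + 1) * S := fun l => by
      calc |P l| ≤ ∑ j ∈ Finset.range (k + 1), 2 * S := by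
            refine (Finset.abs_sum_le_sum_abs _ _).trans (Finset.sum_le_sum fun j hj => ?_)
            rw [abs_mul]
            refine (mul_le_of_le_one_right (abs_nonneg _) (Real.abs_cos_le_one _)).trans ?_
            exact hcoef j (by rw [Finset.mem_range] at hj; omega)
        _ = _ := by rw [Finset.sum_const, Finset.card_range, nsmul_eq_mul]; push_cast; ring
    -- Rounding moves each `T_j` by at most `k²η`; with `k + 1 ≤ 2k` coefficients of size at most
    -- `2S`, the total change is at most `4k³ηS ≤ S/128`.
    have hdiff : ∀ l ∈ K, |P l| - S / 128 ≤ |Q l| := fun l hl => by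
      have h1 : |P l - Q l| ≤ ∑ j ∈ Finset.range (k + 1), 2 * S * ((k : ℝ) ^ 2 * η) := by
        rw [hP, hQ, ← Finset.sum_sub_distrib]
        refine (Finset.abs_sum_le_sum_abs _ _).trans (Finset.sum_le_sum fun j hj => ?_)
        have hjk : j ≤ k := by rw [Finset.mem_range] at hj; omega
        rw [← mul_sub, abs_mul]
        refine mul_le_mul (hcoef j hjk) ?_ (abs_nonneg _) (by positivity)
        have h2 := abs_chebyshev_T_sub_le j (Real.abs_cos_le_one (φ l)) (hXabs l hl)
        rw [Chebyshev.T_real_cos] at h2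
        refine h2.trans ?_
        have h3 : |Real.cos (φ l) - η * ((X l : ℝ) - m / 2)| ≤ η := by
          rw [abs_le]
          constructor <;> linarith [hXle l, hXge l]
        have h4 : (j : ℝ) ≤ k := by exact_mod_cast hjk
        gcongr
      rw [Finset.sum_const, Finset.card_range, nsmul_eq_mul] at h1
      push_cast at h1
      have h2 : ((k : ℝ) + 1) * (2 * S * ((k : ℝ) ^ 2 * η)) ≤ S / 128 := by
        calc _ ≤ (2 * (k : ℝ)) * (2 * S * ((k : ℝ) ^ 2 * η)) := by gcongr
          _ = S / 128 * (η * (512 * (k : ℝ) ^ 3)) := by ring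
          _ ≤ S / 128 * 1 := by gcongr
          _ = _ := mul_one _
      have h3 := abs_sub_abs_le_abs_sub (P l) (Q l)
      linarith
    have hcardK : ((K.card : ℕ) : ℝ) = N - 2 * n := by
      rw [hK, trimmedIndices, Nat.card_Ico]
      have : 2 * n ≤ N := by nlinarith
      rw [show 16 * (k + 1) * n - n - n = N - 2 * n by omega, Nat.cast_sub this]
      push_cast
      ring
    -- The `2n` discarded angles each contribute at most `2(k+1)S`, a quarter of the total `N S`;
    -- over half of the total survives trimming and rounding.
    have hrest : (∑ l ∈ Finset.range N \ K, |P l|) ≤ N * (S / 4) := by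
      calc _ ≤ ∑ l ∈ Finset.range N \ K, 2 * (k + 1) * S := Finset.sum_le_sum fun l _ => hsupP l
        _ = 2 * n * (2 * (k + 1) * S) := by
            rw [Finset.sum_const, nsmul_eq_mul, Finset.cast_card_sdiff hKN, hcardK,
              Finset.card_range]
            ring
        _ = N * (S / 4) := by rw [hNR]; ring
    have hsplit := Finset.sum_sdiff (f := fun l => |P l|) hKN
    have hSN : (∑ l ∈ Finset.range N, |P l|) = N * S := by rw [hS]; field_simp
    have hQsum : ∑ l ∈ K, (|P l| - S / 128) ≤ ∑ l ∈ K, |Q l| := Finset.sum_le_sum hdiff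
    rw [Finset.sum_sub_distrib, Finset.sum_const, nsmul_eq_mul, hcardK] at hQsum
    have h9 : (N : ℝ) * (S / 2) ≤ ∑ l ∈ K, |Q l| := by
      have : 0 ≤ (n : ℝ) * S := by positivity
      have : 0 ≤ (N : ℝ) * S := by positivity
      nlinarith
    calc |a i| ≤ 2 * S := hcoef i hi
      _ = 4 * (N * (S / 2) / N) := by field_simp; ring
      _ ≤ _ := by gcongr

/-! ### Polynomials as combinations of Chebyshev polynomials. -/

/-- The span of the first `n + 1` Chebyshev polynomials in the coordinate `u`. -/
noncomputable def chebyshevSpan {ι : Type*} (u : ι → ℝ) (n : ℕ) : Submodule ℝ (ι → ℝ) :=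
  Submodule.span ℝ ((fun j : ℕ => fun x => (Chebyshev.T ℝ j).eval (u x)) '' Set.Iic n)

theorem chebyshev_mem_chebyshevSpan {ι : Type*} (u : ι → ℝ) {n j : ℕ} (h : j ≤ n) :
    (fun x => (Chebyshev.T ℝ j).eval (u x)) ∈ chebyshevSpan u n :=
  Submodule.subset_span ⟨j, h, rfl⟩

theorem affine_mul_mem_chebyshevSpan {ι : Type*} (u : ι → ℝ) (α β : ℝ) {n : ℕ} {f : ι → ℝ}
    (hf : f ∈ chebyshevSpan u n) : (fun x => (α + β * u x) * f x) ∈ chebyshevSpan u (n + 1) := by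
  have h : chebyshevSpan u n ≤ (chebyshevSpan u (n + 1)).comap
      (LinearMap.mulLeft ℝ (fun x => α + β * u x)) := by
    rw [chebyshevSpan, Submodule.span_le]
    rintro _ ⟨j, hj, rfl⟩
    rw [Set.mem_Iic] at hj
    have h0 := chebyshev_mem_chebyshevSpan u (show j ≤ n + 1 by omega)
    have h1 := chebyshev_mem_chebyshevSpan u (show j + 1 ≤ n + 1 by omega)
    -- In the three-term recurrence the case `j = 0` involves `T_{-1}`, which equals `T_1`.
    obtain ⟨i, hi, hT⟩ : ∃ i ≤ n + 1, Chebyshev.T ℝ ((j : ℤ) - 1) = Chebyshev.T ℝ (i : ℕ) := by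
      rcases j with _ | j
      · exact ⟨1, by omega, by simp [Chebyshev.T_one]⟩
      · exact ⟨j, by omega, by congr 1; push_cast; ring⟩
    have h2 := chebyshev_mem_chebyshevSpan u hi
    have h3 := add_mem (Submodule.smul_mem _ α h0)
      (Submodule.smul_mem _ (β / 2) (add_mem h1 h2))
    rw [SetLike.mem_coe, Submodule.mem_comap]
    convert h3 using 1
    ext x
    have h4 := congrArg (fun p => p.eval (u x)) (Chebyshev.T_add_one ℝ (j : ℤ))
    simp only [hT, eval_sub, eval_mul, eval_X, eval_ofNat] at h4
    simp only [LinearMap.mulLeft_apply, Pi.mul_apply, Pi.add_apply, Pi.smul_apply, smul_eq_mul]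
    push_cast
    rw [h4]
    ring
  exact h hf

theorem affine_pow_mem_chebyshevSpan {ι : Type*} (u : ι → ℝ) (α β : ℝ) (i : ℕ) :
    (fun x => (α + β * u x) ^ i) ∈ chebyshevSpan u i := by
  induction i with
  | zero =>
    convert chebyshev_mem_chebyshevSpan u le_rfl using 1
    ext x
    simp
  | succ i ih =>
    convert affine_mul_mem_chebyshevSpan u α β ih using 1
    ext x
    rw [pow_succ']

theorem chebyshevSpan_mono {ι : Type*} (u : ι → ℝ) {i n : ℕ} (h : i ≤ n) :
    chebyshevSpan u i ≤ chebyshevSpan u n :=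
  Submodule.span_mono (Set.image_mono (Set.Iic_subset_Iic.2 h))

theorem exists_coeff_of_mem_chebyshevSpan {ι : Type*} {u : ι → ℝ} {n : ℕ} {f : ι → ℝ}
    (hf : f ∈ chebyshevSpan u n) :
    ∃ a : ℕ → ℝ, ∀ x, f x = ∑ j ∈ Finset.range (n + 1), a j * (Chebyshev.T ℝ j).eval (u x) := by
  induction hf using Submodule.span_induction with
  | mem f hf =>
    obtain ⟨j, hj, rfl⟩ := hf
    rw [Set.mem_Iic] at hj
    exact ⟨Pi.single j 1, fun x => by
      rw [Finset.sum_eq_single j] <;> simp +contextual [hj]⟩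
  | zero => exact ⟨0, fun x => by simp⟩
  | add f g _ _ hf hg =>
    obtain ⟨a, ha⟩ := hf
    obtain ⟨b, hb⟩ := hg
    exact ⟨a + b, fun x => by simp [ha, hb, add_mul, Finset.sum_add_distrib]⟩
  | smul c f _ hf =>
    obtain ⟨a, ha⟩ := hf
    exact ⟨c • a, fun x => by simp [ha, Finset.mul_sum, mul_assoc]⟩

/-! ### The Ising law as a perturbation of the binomial. -/

/-- The normalization of the quadratic exponential tilt of `Bin(m, 1/2)`. -/
noncomputable def tiltPartition (m : ℕ) (δ : ℝ) : ℝ :=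
  ∑ x ∈ Finset.range (m + 1), binMass m x * Real.exp (δ * stdCoord m x ^ 2 / 2)

/-- Since `h(m, x) = (2x - m)²/2 - m/2`, the constant `exp (-δ/2)` cancels against the
normalization. -/
theorem isingMass_eq {m : ℕ} (hm : 1 ≤ m) (δ : ℝ) (x : ℕ) :
    isingMass m (δ / m) x =
      binMass m x * Real.exp (δ * stdCoord m x ^ 2 / 2) / tiltPartition m δ := by
  have hm0 : (m : ℝ) ≠ 0 := by exact_mod_cast (by omega : m ≠ 0)
  have e : ∀ x, (m.choose x : ℝ) * Real.exp (isingExponent m x * (δ / m)) =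
      (2 ^ m * Real.exp (-(δ / 2))) *
        (binMass m x * Real.exp (δ * stdCoord m x ^ 2 / 2)) := fun x => by
    have h1 : isingExponent m x * (δ / m) = -(δ / 2) + δ * stdCoord m x ^ 2 / 2 := by
      rw [stdCoord_sq, isingExponent]
      field_simp
      ring
    rw [h1, Real.exp_add, binMass]
    field_simp
  unfold isingMass isingPartition tiltPartition
  simp_rw [e]
  rw [← Finset.mul_sum, mul_div_mul_left _ _ (by positivity)]

theorem one_le_tiltPartition {δ : ℝ} (hδ : 0 ≤ δ) (m : ℕ) : 1 ≤ tiltPartition m δ := by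
  rw [← sum_binMass m]
  refine Finset.sum_le_sum fun x _ => le_mul_of_one_le_right (binMass_nonneg _ _) ?_
  exact Real.one_le_exp (by positivity)

theorem exp_sub_one_le {δ : ℝ} (hδ : 0 ≤ δ) (hδ1 : δ ≤ 1 / 32) (s : ℝ) :
    Real.exp (δ * s ^ 2 / 2) - 1 ≤ 32 * δ * Real.exp (s ^ 2 / 32) := by
  set t := δ * s ^ 2 / 2 with ht
  have h1 : Real.exp t - 1 ≤ t * Real.exp t := by
    have h2 := Real.one_sub_le_exp_neg t
    have h3 := mul_le_mul_of_nonneg_right h2 (Real.exp_pos t).le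
    rw [← Real.exp_add, neg_add_cancel, Real.exp_zero] at h3
    linarith
  have h2 : Real.exp t ≤ Real.exp (s ^ 2 / 64) := by
    apply Real.exp_le_exp.2
    rw [ht]
    nlinarith [sq_nonneg s]
  have h3 : s ^ 2 / 64 ≤ Real.exp (s ^ 2 / 64) := by
    linarith [Real.add_one_le_exp (s ^ 2 / 64)]
  calc _ ≤ t * Real.exp t := h1
    _ ≤ t * Real.exp (s ^ 2 / 64) := by gcongr
    _ = 32 * δ * ((s ^ 2 / 64) * Real.exp (s ^ 2 / 64)) := by rw [ht]; ring
    _ ≤ 32 * δ * (Real.exp (s ^ 2 / 64) * Real.exp (s ^ 2 / 64)) := by gcongr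
    _ = _ := by rw [← Real.exp_add]; ring_nf

/-- Closeness of the Ising sum distribution to `Bin(m, 1/2)`. -/
theorem exists_isingMass_sub_binMass_bounds :
    ∃ C : ℝ, 32 ≤ C ∧ ∀ m : ℕ, 1 ≤ m → ∀ δ : ℝ, 0 < δ → C * δ ≤ 1 →
      (∀ x, binMass m x / 2 ≤ isingMass m (δ / m) x) ∧
      ∑ x ∈ Finset.range (m + 1), |isingMass m (δ / m) x - binMass m x| ≤ C * δ ∧
      ∑ x ∈ Finset.range (m + 1), (isingMass m (δ / m) x - binMass m x) ^ 2 / binMass m x ≤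
        C * δ ∧
      ∑ x ∈ Finset.range (m + 1), |isingMass m (δ / m) x - binMass m x| *
        (stdCoord m x ^ 2 * Real.exp |stdCoord m x|) ≤ C * δ := by
  obtain ⟨M, hM1, hM⟩ := exists_sum_binMass_mul_exp_sq_le
  have hC2 : 32 * M ≤ 4096 * M ^ 3 * Real.exp 2 := by
    have h1 : (1 : ℝ) ≤ Real.exp 2 := Real.one_le_exp (by norm_num)
    have h2 : M ≤ M ^ 3 := le_self_pow₀ hM1 (by norm_num)
    have h3 : M ^ 3 ≤ M ^ 3 * Real.exp 2 := le_mul_of_one_le_right (by positivity) h1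
    nlinarith
  refine ⟨4096 * M ^ 3 * Real.exp 2, by linarith, fun m hm δ hδ hCδ => ?_⟩
  set C := 4096 * M ^ 3 * Real.exp 2 with hC
  have h32 : 32 * M * δ ≤ 1 := le_trans (by gcongr) hCδ
  have hδ32 : δ ≤ 1 / 32 := by nlinarith
  have hexp : ∀ (c : ℝ), c ≤ 1 / 4 → ∑ x ∈ Finset.range (m + 1),
      binMass m x * Real.exp (c * stdCoord m x ^ 2) ≤ M := fun c hc => by
    refine le_trans (Finset.sum_le_sum fun x _ => ?_) (hM m hm)
    have := sq_nonneg (stdCoord m x)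
    have := binMass_nonneg m x
    gcongr
    nlinarith
  have hZ1 := one_le_tiltPartition hδ.le m
  have hZ2 : tiltPartition m δ - 1 ≤ 32 * M * δ := by
    rw [tiltPartition, ← sum_binMass m, ← Finset.sum_sub_distrib]
    calc _ ≤ ∑ x ∈ Finset.range (m + 1),
          32 * δ * (binMass m x * Real.exp ((1 / 32) * stdCoord m x ^ 2)) := by
            refine Finset.sum_le_sum fun x _ => ?_
            have h1 := mul_le_mul_of_nonneg_left (exp_sub_one_le hδ.le hδ32 (stdCoord m x))
              (binMass_nonneg m x)
            rw [show (1 / 32) * stdCoord m x ^ 2 = stdCoord m x ^ 2 / 32 by ring]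
            linarith
      _ ≤ 32 * δ * M := by
            rw [← Finset.mul_sum]
            have := hexp (1 / 32) (by norm_num)
            gcongr
      _ = _ := by ring
  have hZ0 : 0 < tiltPartition m δ := by linarith
  -- All the sums follow from this pointwise bound: the weights involved need binomial averages of
  -- `exp (c s²)` only for `c = 1/32`, `1/16` and `7/32`, all below the admissible `1/4`.
  have hpt : ∀ x, |isingMass m (δ / m) x - binMass m x| ≤
      64 * M * δ * (binMass m x * Real.exp (stdCoord m x ^ 2 / 32)) := fun x => by
    have e : isingMass m (δ / m) x - binMass m x = binMass m x *
        ((Real.exp (δ * stdCoord m x ^ 2 / 2) - tiltPartition m δ) / tiltPartition m δ) := by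
      rw [isingMass_eq hm]
      field_simp
    have hb := binMass_nonneg m x
    set g := Real.exp (δ * stdCoord m x ^ 2 / 2) with hg
    set Z := tiltPartition m δ
    set E := Real.exp (stdCoord m x ^ 2 / 32)
    have hg1 : 1 ≤ g := Real.one_le_exp (by positivity)
    have hE1 : 1 ≤ E := Real.one_le_exp (by positivity)
    have hg2 : g - 1 ≤ 32 * δ * E := exp_sub_one_le hδ.le hδ32 _
    rw [e, abs_mul, abs_of_nonneg hb, abs_div, abs_of_pos hZ0]
    have h1 : |g - Z| / Z ≤ |g - Z| := div_le_self (abs_nonneg _) hZ1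
    have h3 : 32 * M * δ ≤ 32 * M * δ * E := le_mul_of_one_le_right (by positivity) hE1
    have h4 : 32 * δ * E ≤ 32 * M * δ * E := by
      have : 0 ≤ 32 * δ * E := by positivity
      nlinarith
    have h2 : |g - Z| ≤ 64 * M * δ * E := by
      rw [abs_le]
      constructor <;> linarith
    calc _ ≤ binMass m x * (64 * M * δ * E) := by gcongr; exact h1.trans h2
      _ = _ := by ring
  have hM2 : M ≤ M ^ 2 := le_self_pow₀ hM1 (by norm_num)
  have hM3 : M ^ 2 ≤ M ^ 3 := pow_le_pow_right₀ hM1 (by norm_num)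
  have he1 : (1 : ℝ) ≤ Real.exp 2 := Real.one_le_exp (by norm_num)
  refine ⟨fun x => ?_, ?_, ?_, ?_⟩
  · have hb := binMass_nonneg m x
    rw [isingMass_eq hm, div_le_div_iff₀ two_pos hZ0]
    have hg1 : 1 ≤ Real.exp (δ * stdCoord m x ^ 2 / 2) := Real.one_le_exp (by positivity)
    nlinarith [mul_le_mul_of_nonneg_left hg1 hb]
  · calc _ ≤ ∑ x ∈ Finset.range (m + 1),
          64 * M * δ * (binMass m x * Real.exp ((1 / 32) * stdCoord m x ^ 2)) := by
            refine Finset.sum_le_sum fun x _ => (hpt x).trans (le_of_eq ?_)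
            ring_nf
      _ ≤ 64 * M * δ * M := by
            rw [← Finset.mul_sum]
            have := hexp (1 / 32) (by norm_num)
            gcongr
      _ = 64 * M ^ 2 * 1 * δ := by ring
      _ ≤ 4096 * M ^ 3 * Real.exp 2 * δ := by gcongr; norm_num
  · calc _ ≤ ∑ x ∈ Finset.range (m + 1),
          4096 * M ^ 2 * δ ^ 2 * (binMass m x * Real.exp ((1 / 16) * stdCoord m x ^ 2)) := by
            refine Finset.sum_le_sum fun x hx => ?_
            have hb := binMass_pos (Nat.lt_succ_iff.1 (Finset.mem_range.1 hx))
            rw [div_le_iff₀ hb, ← sq_abs]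
            refine (pow_le_pow_left₀ (abs_nonneg _) (hpt x) 2).trans (le_of_eq ?_)
            rw [show (1 / 16) * stdCoord m x ^ 2 =
              stdCoord m x ^ 2 / 32 + stdCoord m x ^ 2 / 32 by ring, Real.exp_add]
            ring
      _ ≤ 4096 * M ^ 2 * δ ^ 2 * M := by
            rw [← Finset.mul_sum]
            have := hexp (1 / 16) (by norm_num)
            gcongr
      _ = 4096 * M ^ 3 * δ * δ := by ring
      _ ≤ 4096 * M ^ 3 * Real.exp 2 * δ := by gcongr; linarith
  · calc _ ≤ ∑ x ∈ Finset.range (m + 1), 1024 * M * δ * Real.exp 2 *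
          (binMass m x * Real.exp ((7 / 32) * stdCoord m x ^ 2)) := by
            refine Finset.sum_le_sum fun x hx => ?_
            have hb := binMass_nonneg m x
            set s := stdCoord m x
            have h1 : s ^ 2 ≤ 16 * Real.exp (s ^ 2 / 16) := by
              linarith [Real.add_one_le_exp (s ^ 2 / 16)]
            have h2 : Real.exp |s| ≤ Real.exp 2 * Real.exp (s ^ 2 / 8) := by
              rw [← Real.exp_add, Real.exp_le_exp, ← sq_abs s]
              nlinarith [sq_nonneg (|s| - 4)]
            calc _ ≤ 64 * M * δ * (binMass m x * Real.exp (s ^ 2 / 32)) *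
                  (16 * Real.exp (s ^ 2 / 16) * (Real.exp 2 * Real.exp (s ^ 2 / 8))) := by
                  gcongr
                  exact hpt x
              _ = 1024 * M * δ * Real.exp 2 * (binMass m x *
                  (Real.exp (s ^ 2 / 32) * Real.exp (s ^ 2 / 16) * Real.exp (s ^ 2 / 8))) := by
                  ring
              _ = _ := by rw [← Real.exp_add, ← Real.exp_add]; ring_nf
      _ ≤ 1024 * M * δ * Real.exp 2 * M := by
            rw [← Finset.mul_sum]
            have := hexp (7 / 32) (by norm_num)
            gcongr
      _ = 1024 * M ^ 2 * Real.exp 2 * δ := by ring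
      _ ≤ 4096 * M ^ 3 * Real.exp 2 * δ := by gcongr; norm_num

/-! ### Translation between measures and finite sums. -/

/-- The measure on `ℕ` with masses `a 0, …, a m`. -/
noncomputable def massMeasure (m : ℕ) (a : ℕ → ℝ) : MeasureTheory.Measure ℕ :=
  ∑ x ∈ Finset.range (m + 1), ENNReal.ofReal (a x) • MeasureTheory.Measure.dirac x

theorem binHalf_eq_massMeasure (m : ℕ) : binHalf m = massMeasure m (binMass m) := by
  rw [binHalf, ProbabilityTheory.binomial_eq_sum_dirac, massMeasure]
  have : Finset.Iic m = Finset.range (m + 1) := by ext; simp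
  rw [this]
  refine Finset.sum_congr rfl fun x hx => ?_
  have hx' : x ≤ m := by simpa [Nat.lt_succ_iff] using hx
  congr 2
  have h3 : (2 : ℝ) ^ m = 2 ^ x * 2 ^ (m - x) := by rw [← pow_add]; congr 1; omega
  simp only [binMass, h3]
  norm_num
  rw [one_div_pow, one_div_pow]
  field_simp

theorem massMeasure_apply (m : ℕ) (a : ℕ → ℝ) (S : Set ℕ) :
    massMeasure m a S = ∑ x ∈ Finset.range (m + 1), ENNReal.ofReal (S.indicator a x) := by
  classical
  simp only [massMeasure, MeasureTheory.Measure.finsetSum_apply, MeasureTheory.Measure.smul_apply,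
    MeasureTheory.Measure.dirac_apply, smul_eq_mul]
  refine Finset.sum_congr rfl fun x _ => ?_
  by_cases h : x ∈ S <;> simp [h]

theorem massMeasure_singleton {m x : ℕ} (a : ℕ → ℝ) (hx : x ∈ Finset.range (m + 1)) :
    massMeasure m a {x} = ENNReal.ofReal (a x) := by
  rw [massMeasure_apply, Finset.sum_eq_single x] <;> simp +contextual [Set.indicator]
  intro h
  exact absurd (Finset.mem_range.1 hx) (by omega)

theorem massMeasure_singleton_of_notMem {m x : ℕ} (a : ℕ → ℝ) (hx : x ∉ Finset.range (m + 1)) :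
    massMeasure m a {x} = 0 := by
  rw [massMeasure_apply]
  refine Finset.sum_eq_zero fun y hy => ?_
  have : y ≠ x := fun h => hx (h ▸ hy)
  simp [this]

theorem massMeasure_real {m : ℕ} {a : ℕ → ℝ} (ha : ∀ x, 0 ≤ a x) (S : Set ℕ) :
    (massMeasure m a).real S = ∑ x ∈ Finset.range (m + 1), S.indicator a x := by
  have h : ∀ x, 0 ≤ S.indicator a x := Set.indicator_nonneg fun x _ => ha x
  rw [MeasureTheory.measureReal_def, massMeasure_apply,
    ← ENNReal.ofReal_sum_of_nonneg fun x _ => h x,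
    ENNReal.toReal_ofReal (Finset.sum_nonneg fun x _ => h x)]

theorem integral_massMeasure {m : ℕ} {a : ℕ → ℝ} (ha : ∀ x, 0 ≤ a x) (f : ℕ → ℝ) :
    ∫ x, f x ∂massMeasure m a = ∑ x ∈ Finset.range (m + 1), a x * f x := by
  rw [massMeasure, MeasureTheory.integral_finsetSum_measure]
  · refine Finset.sum_congr rfl fun x _ => ?_
    rw [MeasureTheory.integral_smul_measure, MeasureTheory.integral_dirac,
      ENNReal.toReal_ofReal (ha x), smul_eq_mul]
  · exact fun _ _ => (MeasureTheory.integrable_dirac (by simp)).smul_measure (by simp)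

theorem tvDistance_massMeasure_le {m : ℕ} {a b : ℕ → ℝ} (ha : ∀ x, 0 ≤ a x) (hb : ∀ x, 0 ≤ b x) :
    tvDistance (massMeasure m a) (massMeasure m b) ≤
      ∑ x ∈ Finset.range (m + 1), |a x - b x| := by
  refine ciSup_le fun S => ?_
  rw [massMeasure_real ha, massMeasure_real hb, ← Finset.sum_sub_distrib]
  refine (Finset.abs_sum_le_sum_abs _ _).trans (Finset.sum_le_sum fun x _ => ?_)
  by_cases h : x ∈ S <;> simp [h]

theorem chiSquared_massMeasure_le {m : ℕ} {a b : ℕ → ℝ} (ha : ∀ x, 0 ≤ a x)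
    (hb : ∀ x ∈ Finset.range (m + 1), 0 < b x) {c : ℝ} (hc : 0 ≤ c)
    (h : ∑ x ∈ Finset.range (m + 1), a x ^ 2 / b x ≤ 1 + c) :
    chiSquared (massMeasure m a) (massMeasure m b) ≤ ENNReal.ofReal c := by
  unfold chiSquared
  rw [tsum_eq_sum (s := Finset.range (m + 1)) fun x hx => by
    rw [massMeasure_singleton_of_notMem a hx]; simp]
  have h1 : ∀ x ∈ Finset.range (m + 1), massMeasure m a {x} ^ 2 / massMeasure m b {x} =
      ENNReal.ofReal (a x ^ 2 / b x) := fun x hx => by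
    rw [massMeasure_singleton a hx, massMeasure_singleton b hx,
      ENNReal.ofReal_div_of_pos (hb x hx), ENNReal.ofReal_pow (ha x)]
  rw [Finset.sum_congr rfl h1, ← ENNReal.ofReal_sum_of_nonneg fun x hx =>
    div_nonneg (sq_nonneg _) (hb x hx).le, tsub_le_iff_right, ← ENNReal.ofReal_one,
    ← ENNReal.ofReal_add hc zero_le_one]
  exact ENNReal.ofReal_le_ofReal (by linarith)

/-! ### Construction of the moment-matching law. -/

/-- Moment corrections dominated by a weight, from a weighted `ℓ¹` bound on the moment defect. -/
theorem exists_moment_correction {m k : ℕ} (u ν w : ℕ → ℝ) (hw : ∀ x, 0 ≤ w x)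
    (h : ∀ a : ℕ → ℝ,
      ∑ x ∈ Finset.range (m + 1), ν x *
          ∑ j ∈ Finset.range (k + 1), a j * (Chebyshev.T ℝ j).eval (u x) ≤
        ∑ x ∈ Finset.range (m + 1), w x *
          |∑ j ∈ Finset.range (k + 1), a j * (Chebyshev.T ℝ j).eval (u x)|) :
    ∃ q : ℕ → ℝ, (∀ x, |q x| ≤ w x) ∧ ∀ α β : ℝ, ∀ i ≤ k,
      ∑ x ∈ Finset.range (m + 1), q x * (α + β * u x) ^ i =
        ∑ x ∈ Finset.range (m + 1), ν x * (α + β * u x) ^ i := by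
  obtain ⟨q, hq1, hq2⟩ := exists_abs_le_of_le_sum_mul_abs
    (chebyshevSpan (fun x : Fin (m + 1) => u x) k) (fun x => ν x) (fun x => w x)
    (fun x => hw x) (fun v hv => by
      obtain ⟨a, ha⟩ := exists_coeff_of_mem_chebyshevSpan hv
      have := h a
      rw [Finset.sum_range, Finset.sum_range] at this
      simp_rw [ha]
      exact this)
  refine ⟨fun x => if hx : x < m + 1 then q ⟨x, hx⟩ else 0, fun x => ?_, fun α β i hi => ?_⟩
  · by_cases hx : x < m + 1
    · simpa [hx] using hq1 ⟨x, hx⟩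
    · simpa [hx] using hw x
  · have := hq2 _ (chebyshevSpan_mono _ hi (affine_pow_mem_chebyshevSpan _ α β i))
    rw [Finset.sum_range, Finset.sum_range, ← this]
    exact Finset.sum_congr rfl fun x _ => by simp only [dif_pos x.2]

theorem isingMass_reflect {m x : ℕ} (hm : 1 ≤ m) (h : x ≤ m) (δ : ℝ) :
    isingMass m (δ / m) (m - x) = isingMass m (δ / m) x := by
  rw [isingMass_eq hm, isingMass_eq hm, binMass_reflect h, stdCoord_reflect h, neg_sq]

theorem sum_isingMass (m : ℕ) (δ : ℝ) : ∑ x ∈ Finset.range (m + 1), isingMass m δ x = 1 := by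
  unfold isingMass
  rw [← Finset.sum_div]
  exact div_self (isingPartition_pos m δ).ne'

/-- The Chebyshev moments of the difference of `Bin(m, 1/2)` and `IS(m, δ / m)`. -/
theorem abs_sum_sub_mul_chebyshev_le {m : ℕ} (hm : 1 ≤ m) (δ : ℝ) {R : ℝ} (hR : 0 < R) {j : ℕ}
    (hj : (j : ℝ) ≤ R) :
    |∑ x ∈ Finset.range (m + 1), (binMass m x - isingMass m (δ / m) x) *
        (Chebyshev.T ℝ j).eval (stdCoord m x / R)| ≤
      (j : ℝ) ^ 2 / (2 * R ^ 2) * ∑ x ∈ Finset.range (m + 1),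
        |isingMass m (δ / m) x - binMass m x| *
          (stdCoord m x ^ 2 * Real.exp |stdCoord m x|) := by
  rcases Nat.even_or_odd j with hev | hodd
  · obtain ⟨n, hn⟩ := hev.exists_two_nsmul
    rw [smul_eq_mul] at hn
    subst hn
    have h0 : ∑ x ∈ Finset.range (m + 1), (binMass m x - isingMass m (δ / m) x) *
        (Chebyshev.T ℝ (2 * n : ℕ)).eval (0 : ℝ) = 0 := by
      rw [← Finset.sum_mul, Finset.sum_sub_distrib, sum_binMass, sum_isingMass, sub_self, zero_mul]
    -- Equal total masses allow subtracting the constant `T_{2n}(0)`, which leaves a deviation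
    -- quadratic in `s/R`.
    rw [← sub_zero (∑ x ∈ Finset.range (m + 1), _), ← h0, ← Finset.sum_sub_distrib,
      Finset.mul_sum]
    refine (Finset.abs_sum_le_sum_abs _ _).trans (Finset.sum_le_sum fun x _ => ?_)
    rw [← mul_sub, abs_mul, abs_sub_comm]
    set s := stdCoord m x
    have h1 := abs_chebyshev_T_two_mul_sub_le n (s / R)
    have h2 : Real.cosh (2 * n * (s / R)) ≤ Real.exp |s| := by
      push_cast at hj
      have h3 : |2 * n * (s / R)| ≤ |s| := by
        rw [abs_mul, abs_div, abs_of_pos hR, abs_of_nonneg (by positivity), ← mul_div_assoc,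
          div_le_iff₀ hR, mul_comm]
        gcongr
      rw [← Real.cosh_abs]
      refine le_trans ?_ (Real.exp_le_exp.2 h3)
      rw [Real.cosh_eq]
      have : Real.exp (-|2 * n * (s / R)|) ≤ Real.exp |2 * n * (s / R)| :=
        Real.exp_le_exp.2 (by linarith [abs_nonneg (2 * n * (s / R))])
      linarith
    calc _ ≤ |isingMass m (δ / m) x - binMass m x| *
          (2 * (n : ℝ) ^ 2 * (s / R) ^ 2 * Real.exp |s|) := by
          gcongr
          exact h1.trans (by gcongr)
      _ = _ := by push_cast; field_simp
  · set F : ℕ → ℝ := fun x => (binMass m x - isingMass m (δ / m) x) *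
        (Chebyshev.T ℝ j).eval (stdCoord m x / R) with hF
    -- Reflection `x ↦ m - x` fixes both laws and negates an odd Chebyshev polynomial.
    have h1 : ∑ x ∈ Finset.range (m + 1), F x = -∑ x ∈ Finset.range (m + 1), F x := by
      conv_lhs => rw [← Finset.sum_range_reflect]
      rw [← Finset.sum_neg_distrib]
      refine Finset.sum_congr rfl fun x hx => ?_
      have hx' : x ≤ m := Nat.lt_succ_iff.1 (Finset.mem_range.1 hx)
      rw [hF]
      simp only [Nat.add_sub_cancel]
      rw [binMass_reflect hx', isingMass_reflect hm hx', stdCoord_reflect hx', neg_div,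
        Chebyshev.T_eval_neg]
      have : (((j : ℤ).negOnePow : ℤˣ) : ℤ) = -1 := by
        rw [Int.negOnePow_odd _ (by exact_mod_cast hodd)]; rfl
      rw [this]
      push_cast
      ring
    have h2 : ∑ x ∈ Finset.range (m + 1), F x = 0 := by linarith
    rw [h2, abs_zero]
    positivity

/-- The moment-matching masses in the range `k³ ≤ log (1 / δ)`; here `L` stands for
`log (1 / δ)`. -/
theorem exists_moment_matching_mass {C : ℝ} (hC : 32 ≤ C) {m k : ℕ} (hk : 1 ≤ k) {δ L : ℝ}
    (hδ : 0 < δ) (hL : δ = Real.exp (-L)) (hLC : 32768 * C ≤ L) (hkL : (k : ℝ) ^ 3 ≤ L)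
    (hmL : 16777216 * L ^ 3 ≤ m) (hCδ : C * δ ≤ 1)
    (hlow : ∀ x, binMass m x / 2 ≤ isingMass m (δ / m) x)
    (hchi : ∑ x ∈ Finset.range (m + 1), (isingMass m (δ / m) x - binMass m x) ^ 2 / binMass m x ≤
      C * δ)
    (hmom : ∑ x ∈ Finset.range (m + 1), |isingMass m (δ / m) x - binMass m x| *
        (stdCoord m x ^ 2 * Real.exp |stdCoord m x|) ≤ C * δ) :
    ∃ a : ℕ → ℝ, (∀ x, 0 ≤ a x) ∧
      (∀ i ≤ k, ∑ x ∈ Finset.range (m + 1), a x * (x : ℝ) ^ i =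
        ∑ x ∈ Finset.range (m + 1), binMass m x * (x : ℝ) ^ i) ∧
      ∑ x ∈ Finset.range (m + 1), |a x - isingMass m (δ / m) x| ≤
        66 * C * (δ * (k : ℝ) ^ 3 / L) ∧
      ∑ x ∈ Finset.range (m + 1), a x ^ 2 / binMass m x ≤ 1 + 66 * C * δ := by
  have hL1 : 1048576 ≤ L := by linarith
  have hL0 : 0 < L := by linarith
  have hk1 : (1 : ℝ) ≤ k := by exact_mod_cast hk
  have hLm : L ≤ m := by
    have h1 : L ≤ L ^ 3 := le_self_pow₀ (by linarith) (by norm_num)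
    have : 0 < L ^ 3 := by positivity
    linarith
  have hm0 : (0 : ℝ) < m := by linarith
  have hm : 1 ≤ m := by exact_mod_cast hm0
  have hsm : 0 < √(m : ℝ) := Real.sqrt_pos.2 hm0
  have hsL : 0 < √L := Real.sqrt_pos.2 hL0
  have hsmm : √(m : ℝ) * √m = m := Real.mul_self_sqrt hm0.le
  have hsLL : √L * √L = L := Real.mul_self_sqrt hL0.le
  have hsLm : √L ≤ √m := Real.sqrt_le_sqrt hLm
  -- Two demands on `R`: `k ≤ R` keeps `cosh (j s/R)` below `exp |s|`, while `R² = L/16` keeps the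
  -- binomial mass on `|s| ≤ R` well above `δ/√m`.
  set R := √L / 4 with hR
  have hR0 : 0 < R := by positivity
  have hRR : R ^ 2 = L / 16 := by rw [hR, div_pow, sq, hsLL]; norm_num
  have hkR : (k : ℝ) ≤ R := by
    refine le_of_pow_le_pow_left₀ (n := 6) (by norm_num) hR0.le ?_
    calc (k : ℝ) ^ 6 = (k ^ 3) ^ 2 := by ring
      _ ≤ L ^ 2 := by gcongr
      _ ≤ (L / 16) ^ 3 := by
          have : 0 ≤ L ^ 2 := by positivity
          nlinarith
      _ = R ^ 6 := by rw [← hRR]; ring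
  set η := 2 / (√m * R) with hη
  have hη0 : 0 < η := by positivity
  have hu : ∀ x : ℕ, η * ((x : ℝ) - m / 2) = stdCoord m x / R := fun x => by
    rw [hη, stdCoord]; field_simp
  obtain ⟨w, hw0, hwle, hwsupp, hwsum, hwcoef⟩ := exists_chebyshev_grid_weights (k := k) (m := m)
    hk hη0 (by
      rw [hη, div_mul_eq_mul_div, le_div_iff₀ (by positivity)]
      have : √m * R ≤ √m * √m := by gcongr; rw [hR]; linarith
      linarith)
    (by
      rw [hη, div_mul_eq_mul_div, div_le_one (by positivity)]
      -- The constant in the lower bound on `m` is `16777216 = 4096²`; with `k³ ≤ L` this makes the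
      -- grid fine enough for the rounding.
      have h1 : 4096 * L ^ 2 ≤ √m * √L := by
        refine abs_le_of_sq_le_sq' ?_ (by positivity) |>.2
        rw [mul_pow, mul_pow, sq (√(m : ℝ)), sq (√L), hsmm, hsLL]
        have := mul_le_mul_of_nonneg_right hmL hL0.le
        linarith
      rw [hR]
      nlinarith)
  simp only [hu] at hwsupp hwcoef
  -- `64 = 2 · 4 · 8`: at most `2k` coefficients, each at most `4` times the weighted norm, against
  -- Chebyshev moments at most `8Cδk²/L`.
  set B := 64 * C * (δ * (k : ℝ) ^ 3 / L) with hB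
  have hB0 : 0 ≤ B := by positivity
  have hBδ : B ≤ 64 * C * δ := by
    rw [hB]
    gcongr
    rw [div_le_iff₀ hL0]
    gcongr
  have hcheb : ∀ j ∈ Finset.range (k + 1),
      |∑ x ∈ Finset.range (m + 1), (binMass m x - isingMass m (δ / m) x) *
        (Chebyshev.T ℝ j).eval (stdCoord m x / R)| ≤ 8 * C * δ * (k : ℝ) ^ 2 / L := fun j hj => by
    have hjk : (j : ℝ) ≤ k := by
      exact_mod_cast Nat.lt_succ_iff.1 (Finset.mem_range.1 hj)
    refine (abs_sum_sub_mul_chebyshev_le hm δ hR0 (hjk.trans hkR)).trans ?_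
    calc _ ≤ (k : ℝ) ^ 2 / (2 * R ^ 2) * (C * δ) := by gcongr
      _ = _ := by rw [hRR]; field_simp; norm_num
  obtain ⟨q, hq1, hq2⟩ := exists_moment_correction (m := m) (k := k)
    (fun x => stdCoord m x / R) (fun x => binMass m x - isingMass m (δ / m) x)
    (fun x => B * w x) (fun x => mul_nonneg hB0 (hw0 x)) (fun a => by
      set M := ∑ x ∈ Finset.range (m + 1), w x * |∑ j ∈ Finset.range (k + 1),
        a j * (Chebyshev.T ℝ j).eval (stdCoord m x / R)| with hM
      have hM0 : 0 ≤ M := Finset.sum_nonneg fun x _ => mul_nonneg (hw0 x) (abs_nonneg _)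
      have e : ∑ x ∈ Finset.range (m + 1), (binMass m x - isingMass m (δ / m) x) *
          ∑ j ∈ Finset.range (k + 1), a j * (Chebyshev.T ℝ j).eval (stdCoord m x / R) =
          ∑ j ∈ Finset.range (k + 1), a j * ∑ x ∈ Finset.range (m + 1),
            (binMass m x - isingMass m (δ / m) x) *
              (Chebyshev.T ℝ j).eval (stdCoord m x / R) := by
        simp_rw [Finset.mul_sum]
        rw [Finset.sum_comm]
        exact Finset.sum_congr rfl fun j _ => Finset.sum_congr rfl fun x _ => by ring
      rw [e]
      simp_rw [mul_assoc B]
      rw [← Finset.mul_sum]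
      calc _ ≤ ∑ j ∈ Finset.range (k + 1), (4 * M) * (8 * C * δ * (k : ℝ) ^ 2 / L) := by
            refine (le_abs_self _).trans ((Finset.abs_sum_le_sum_abs _ _).trans
              (Finset.sum_le_sum fun j hj => ?_))
            rw [abs_mul]
            exact mul_le_mul (hwcoef a j (Nat.lt_succ_iff.1 (Finset.mem_range.1 hj)))
              (hcheb j hj) (abs_nonneg _) (by positivity)
        _ = (k + 1) * (4 * M * (8 * C * δ * (k : ℝ) ^ 2 / L)) := by
            rw [Finset.sum_const, Finset.card_range, nsmul_eq_mul]
            push_cast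
            ring
        _ ≤ (2 * k) * (4 * M * (8 * C * δ * (k : ℝ) ^ 2 / L)) := by gcongr; linarith
        _ = B * M := by rw [hB]; ring)
  -- Nonnegativity of `A`: the correction is at most half the binomial mass, which the Ising mass
  -- dominates.
  have hwb : ∀ x ∈ Finset.range (m + 1), B * w x ≤ binMass m x / 2 := fun x hx => by
    have hxm := Nat.lt_succ_iff.1 (Finset.mem_range.1 hx)
    rcases eq_or_ne (w x) 0 with h0 | h0
    · rw [h0, mul_zero]
      linarith [binMass_nonneg m x]
    have hs := hwsupp x h0
    rw [abs_div, abs_of_pos hR0, div_le_one hR0] at hs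
    have hs2 : stdCoord m x ^ 2 ≤ L / 16 := by
      rw [← sq_abs, ← hRR]
      gcongr
    have h1 := exp_neg_stdCoord_sq_le_binMass hm hxm (by
      have : 2 * (x : ℝ) - m = stdCoord m x * √m := by rw [stdCoord]; field_simp
      rw [this, abs_mul, abs_of_pos hsm]
      have : |stdCoord m x| * √m ≤ R * √m := by gcongr
      rw [hR] at this
      nlinarith)
    have h2 : Real.exp (-(L / 16)) / (4 * √m) ≤ binMass m x := le_trans (by gcongr) h1
    have h3 : w x ≤ 20 / √m := by
      refine (hwle x).trans ?_
      calc 5 * ((k : ℝ) + 1) * η ≤ 5 * (2 * R) * η := by gcongr; linarith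
        _ = 20 / √m := by rw [hη]; field_simp; norm_num
    have h4 : 10240 * C * δ ≤ Real.exp (-(L / 16)) := by
      have h5 : 10240 * C ≤ Real.exp (15 * L / 16) := by
        have := Real.add_one_le_exp (15 * L / 16)
        linarith
      calc 10240 * C * δ ≤ Real.exp (15 * L / 16) * δ := by gcongr
        _ = _ := by rw [hL, ← Real.exp_add]; ring_nf
    calc B * w x ≤ (64 * C * δ) * (20 / √m) := by
          gcongr
          exact hw0 x
      _ = 10240 * C * δ / (4 * √m) / 2 := by field_simp; norm_num
      _ ≤ Real.exp (-(L / 16)) / (4 * √m) / 2 := by gcongr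
      _ ≤ _ := by gcongr
  have hBsum : ∑ x ∈ Finset.range (m + 1), B * w x ≤ B := by
    rw [← Finset.mul_sum]
    exact mul_le_of_le_one_right hB0 hwsum
  have hpow : ∀ x : ℕ, (x : ℝ) = (m : ℝ) / 2 + 1 / η * (stdCoord m x / R) := fun x => by
    rw [← hu]; field_simp; ring
  have hqpow : ∀ i ≤ k, ∑ x ∈ Finset.range (m + 1), q x * (x : ℝ) ^ i =
      ∑ x ∈ Finset.range (m + 1), (binMass m x - isingMass m (δ / m) x) * (x : ℝ) ^ i :=
    fun i hi => by
      have := hq2 ((m : ℝ) / 2) (1 / η) i hi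
      simp only [← hpow] at this
      exact this
  -- Degree `0` is among the matched moments, so the correction has total mass zero; the linear
  -- terms of chi-squared then vanish.
  have hq0 : ∑ x ∈ Finset.range (m + 1), q x = 0 := by
    have := hqpow 0 (by omega)
    simp only [pow_zero, mul_one] at this
    rw [this, Finset.sum_sub_distrib, sum_binMass, sum_isingMass, sub_self]
  set a : ℕ → ℝ := fun x =>
    if x ∈ Finset.range (m + 1) then isingMass m (δ / m) x + q x else 0 with ha
  have haeq : ∀ x ∈ Finset.range (m + 1), a x = isingMass m (δ / m) x + q x :=
    fun x hx => if_pos hx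
  refine ⟨a, fun x => ?_, fun i hi => ?_, ?_, ?_⟩
  · by_cases hx : x ∈ Finset.range (m + 1)
    · rw [haeq x hx]
      linarith [hlow x, hwb x hx, (abs_le.1 (hq1 x)).1]
    · exact (if_neg hx).ge
  · rw [Finset.sum_congr rfl fun x hx => by rw [haeq x hx, add_mul], Finset.sum_add_distrib,
      hqpow i hi, ← Finset.sum_add_distrib]
    exact Finset.sum_congr rfl fun x _ => by ring
  · calc _ ≤ ∑ x ∈ Finset.range (m + 1), B * w x := by
          refine Finset.sum_le_sum fun x hx => ?_
          rw [haeq x hx, add_sub_cancel_left]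
          exact hq1 x
      _ ≤ B := hBsum
      _ ≤ _ := by rw [hB]; gcongr; norm_num
  -- Expand the square of `Bin + (IS - Bin) + q`; since `|q|` is at most both `B w` and half the
  -- binomial mass, `2q²/Bin ≤ B w`.
  · have hpt : ∀ x ∈ Finset.range (m + 1), a x ^ 2 / binMass m x ≤
        binMass m x + 2 * (isingMass m (δ / m) x - binMass m x) + 2 * q x +
          2 * ((isingMass m (δ / m) x - binMass m x) ^ 2 / binMass m x) + B * w x :=
      fun x hx => by
        have hb := binMass_pos (Nat.lt_succ_iff.1 (Finset.mem_range.1 hx))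
        have h1 : q x ^ 2 ≤ (B * w x) * (binMass m x / 2) := by
          rw [← sq_abs, sq]
          exact mul_le_mul (hq1 x) ((hq1 x).trans (hwb x hx)) (abs_nonneg _)
            (mul_nonneg hB0 (hw0 x))
        rw [haeq x hx, div_le_iff₀ hb]
        have h2 : (isingMass m (δ / m) x - binMass m x) ^ 2 / binMass m x * binMass m x =
          (isingMass m (δ / m) x - binMass m x) ^ 2 := by field_simp
        nlinarith [sq_nonneg (isingMass m (δ / m) x - binMass m x - q x)]
    refine (Finset.sum_le_sum hpt).trans ?_
    simp only [Finset.sum_add_distrib, ← Finset.mul_sum, Finset.sum_sub_distrib, sum_binMass,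
      sum_isingMass, hq0]
    rw [← Finset.mul_sum] at hBsum
    linarith

theorem proposition5p5 :
    ∃ C₀ > (0 : ℝ), ∃ δ₀ > (0 : ℝ), ∃ K > (0 : ℝ),
      ∀ δ : ℝ, 0 < δ → δ < δ₀ →
      ∀ k : ℕ, 1 ≤ k →
      ∀ m : ℕ, max (C₀ * Real.log (1 / δ) ^ 3) ((k : ℝ) ^ 2 / Real.log (1 / δ)) ≤ (m : ℝ) →
        ∃ A : MeasureTheory.Measure ℕ,
          MeasureTheory.IsProbabilityMeasure A ∧
          A (Set.Iic m) = 1 ∧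
          (∀ i : ℕ, 1 ≤ i → i ≤ k →
            ∫ x, (x : ℝ) ^ i ∂A = ∫ x, (x : ℝ) ^ i ∂(binHalf m)) ∧
          tvDistance A (isingSum m (δ / m)) ≤ K * (δ * (k : ℝ) ^ 3 / Real.log (1 / δ)) ∧
          chiSquared A (binHalf m) ≤ ENNReal.ofReal (K * δ) := by
  obtain ⟨C, hC, hbounds⟩ := exists_isingMass_sub_binMass_bounds
  -- This `δ₀` forces `L ≥ 32768 C`, making `L` large enough for every later comparison.
  refine ⟨16777216, by norm_num, Real.exp (-(32768 * C)), Real.exp_pos _, 66 * C, by linarith,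
    fun δ hδ hδ0 k hk m hmax => ?_⟩
  set L := Real.log (1 / δ) with hLdef
  have hL : δ = Real.exp (-L) := by
    rw [hLdef, one_div, Real.log_inv, neg_neg, Real.exp_log hδ]
  have hLC : 32768 * C ≤ L := by
    rw [hL, Real.exp_lt_exp] at hδ0
    linarith
  have hL0 : 0 < L := by linarith
  have hCδ : C * δ ≤ 1 := by
    rw [hL, Real.exp_neg, ← div_eq_mul_inv, div_le_one (Real.exp_pos _)]
    linarith [Real.add_one_le_exp L]
  have hmL : 16777216 * L ^ 3 ≤ m := (le_max_left _ _).trans hmax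
  have hm : 1 ≤ m := by
    have h1 : (0 : ℝ) < m := lt_of_lt_of_le (by positivity) hmL
    exact_mod_cast h1
  obtain ⟨hlow, htv, hchi, hmom⟩ := hbounds m hm δ hδ hCδ
  obtain ⟨a, ha0, hamom, hatv, hachi⟩ : ∃ a : ℕ → ℝ, (∀ x, 0 ≤ a x) ∧
      (∀ i ≤ k, ∑ x ∈ Finset.range (m + 1), a x * (x : ℝ) ^ i =
        ∑ x ∈ Finset.range (m + 1), binMass m x * (x : ℝ) ^ i) ∧
      ∑ x ∈ Finset.range (m + 1), |a x - isingMass m (δ / m) x| ≤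
        66 * C * (δ * (k : ℝ) ^ 3 / L) ∧
      ∑ x ∈ Finset.range (m + 1), a x ^ 2 / binMass m x ≤ 1 + 66 * C * δ := by
    rcases le_or_gt ((k : ℝ) ^ 3) L with hkL | hkL
    · exact exists_moment_matching_mass hC hk hδ hL hLC hkL hmL hCδ hlow hchi hmom
    -- Here `δ < δ k³/L`, so the `O(δ)` distance from the binomial to the Ising law is already
    -- allowed.
    · refine ⟨binMass m, binMass_nonneg m, fun i _ => rfl, ?_, ?_⟩
      · simp_rw [abs_sub_comm (binMass m _)]
        refine htv.trans ?_
        have h1 : δ ≤ δ * (k : ℝ) ^ 3 / L := by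
          rw [le_div_iff₀ hL0]
          gcongr
        exact mul_le_mul (by linarith) h1 hδ.le (by linarith)
      · have h1 : ∀ x ∈ Finset.range (m + 1), binMass m x ^ 2 / binMass m x = binMass m x :=
          fun x hx => by
            have hb := binMass_pos (Nat.lt_succ_iff.1 (Finset.mem_range.1 hx))
            field_simp
        rw [Finset.sum_congr rfl h1, sum_binMass]
        have : 0 ≤ C * δ := by positivity
        linarith
  have hsum : ∑ x ∈ Finset.range (m + 1), a x = 1 := by
    have := hamom 0 (by omega)
    simp only [pow_zero, mul_one] at this
    rw [this, sum_binMass]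
  have hA : ∀ S : Set ℕ, (∀ x ∈ Finset.range (m + 1), x ∈ S) → massMeasure m a S = 1 :=
    fun S hS => by
      rw [massMeasure_apply, Finset.sum_congr rfl fun x hx => by
        rw [Set.indicator_of_mem (hS x hx)], ← ENNReal.ofReal_sum_of_nonneg fun x _ => ha0 x,
        hsum, ENNReal.ofReal_one]
  refine ⟨massMeasure m a, ⟨hA _ fun x _ => Set.mem_univ x⟩,
    hA _ fun x hx => Nat.lt_succ_iff.1 (Finset.mem_range.1 hx), fun i _ hik => ?_, ?_, ?_⟩
  · rw [binHalf_eq_massMeasure, integral_massMeasure ha0,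
      integral_massMeasure (binMass_nonneg m), hamom i hik]
  · exact (tvDistance_massMeasure_le ha0 (isingMass_nonneg m _)).trans hatv
  · rw [binHalf_eq_massMeasure]
    exact chiSquared_massMeasure_le ha0
      (fun x hx => binMass_pos (Nat.lt_succ_iff.1 (Finset.mem_range.1 hx))) (by positivity) hachi
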